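/- Let $m\ge 1$, let $n=2m+1$, and let $B$ be a braid on $n-1=2m$ strands, given by a word in the generators $\sigma_1^{\pm1},\dots,\sigma_{n-2}^{\pm1}$. Here $\sigma_i$ is drawn from top to bottom as the crossing of the strands at positions $i,i+1$ whose over-strand runs between top left and bottom right (a left-handed crossing when both strands run in the same direction), and $\sigma_i^{-1}$ is its mirror image. Let $P(B)$ be the plat closure of $B$, obtained by joining the positions $2j-1$ and $2j$, $1\le j\le m$, by caps at the top and by cups at the bottom, with any orientation of this link. Let $w_B$ be the writhe of $B$ with the orientation of the strands that $P(B)$ induces: a letter $\sigma_i^{\varepsilon}$, $\varepsilon=\pm1$, contributes $\varepsilon$ if its two strands run in the same direction (both up or both down), and $-\varepsilon$ if they run in opposite directions. Let $\phi=\frac{1+\sqrt5}{2}$. Let $U_\sigma$ be a three-qubit unitary that preserves the span of $|010\rangle,|011\rangle,|101\rangle,|110\rangle,|111\rangle$ and has on it the matrix elements $$\langle 101|U_\sigma|101\rangle=\phi^{-1}e^{4\pi i/5},\quad \langle 111|U_\sigma|111\rangle=-\phi^{-1},\quad \langle 111|U_\sigma|101\rangle=\langle 101|U_\sigma|111\rangle=\phi^{-1/2}e^{-3\pi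 i/5},$$ $$\langle 010|U_\sigma|010\rangle=e^{-4\pi i/5},\quad \langle 011|U_\sigma|011\rangle=\langle 110|U_\sigma|110\rangle=e^{3\pi i/5},$$ all others between these five strings being $0$; its action on the span of $|000\rangle,|001\rangle,|100\rangle$ is an arbitrary unitary. On $n$ qubits numbered $0,\dots,n-1$, let $U_{\sigma_i}$ be the gate $U_\sigma$ applied to the qubits $i-1,i,i+1$, put $U_{\sigma_i^{-1}}=U_{\sigma_i}^\dagger$, and let $U_B$ be the product of these operators along the braid word. Let $|\alpha\rangle=|0101\cdots10\rangle$ be the $n$-qubit basis state with bit $1$ exactly at the odd positions. Let $V_L(t)\in\mathbb Z[t^{\pm1/2}]$ be the Jones polynomial of an oriented link $L$, that is $V_L(A^{-4})=(-A^3)^{-\mathrm{wr}(D)}\langle D\rangle(A)$ for a diagram $D$ of $L$, where $\langle D\rangle$ is the Kauffman bracket, equal to $1$ on a crossingless circle, and $\mathrm{wr}(D)$ counts right-handed crossings as $+1$ and left-handed ones as $-1$ (so $V_L$ is $1$ on the unknot and $t+t^3-t^4$ on the right-handed trefoil). Let $V_L(e^{2\pi i/5})$ be its value at $t=e^{2\pi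 i/5}$ with $t^{1/2}=e^{6\pi i/5}$, that is at $A=e^{-3\pi i/5}$. Then $$V_{P(B)}\bigl(e^{2\pi i/5}\bigr)=\bigl(-e^{-3\pi i/5}\bigr)^{3w_B}\,\phi^{\frac n2-\frac32}\,\langle\alpha|U_B|\alpha\rangle .$$ -/

import Mathlib

open scoped LaurentPolynomial

noncomputable section

/-! ### Oriented link diagrams and the Jones polynomial -/

/-- A link diagram cut at finitely many points into pieces: plain arcs, with two ends each, and
crossings, with four corners each. The corners `0, 1, 2, 3` of a crossing are listed
counterclockwise; the under-strand joins the corners `0` and `2`, the over-strand joins the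
corners `1` and `3`. Each cut point is a place where exactly two ends of pieces meet, and `glue`
names these two ends as the two sides of that point. -/
structure LinkDiagram where
  Point : Type
  Arc : Type
  Crossing : Type
  [finitePoint : Finite Point]
  [fintypeCrossing : Fintype Crossing]
  [decEqCrossing : DecidableEq Crossing]
  glue : (Arc × Fin 2) ⊕ (Crossing × Fin 4) ≃ Point × Bool

attribute [instance] LinkDiagram.finitePoint LinkDiagram.fintypeCrossing
  LinkDiagram.decEqCrossing

namespace LinkDiagram

/-- The cut point at end `e` of the arc `a`. -/
def arcPt (D : LinkDiagram) (a : D.Arc) (e : Fin 2) : D.Point := (D.glue (Sum.inl (a, e))).1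

/-- The cut point at corner `q` of the crossing `x`. -/
def cornerPt (D : LinkDiagram) (x : D.Crossing) (q : Fin 4) : D.Point :=
  (D.glue (Sum.inr (x, q))).1

/-- An orientation of the link: `out e` says that the strand which passes through the end `e` of a
piece leaves that piece there. A strand enters a piece at one end and leaves it at the other, and
at a cut point it leaves one piece and enters the next one. -/
structure Orientation (D : LinkDiagram) where
  out : (D.Arc × Fin 2) ⊕ (D.Crossing × Fin 4) → Bool
  arc : ∀ a, out (Sum.inl (a, 0)) ≠ out (Sum.inl (a, 1))
  underStrand : ∀ x, out (Sum.inr (x, 0)) ≠ out (Sum.inr (x, 2))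
  overStrand : ∀ x, out (Sum.inr (x, 1)) ≠ out (Sum.inr (x, 3))
  point : ∀ p, out (D.glue.symm (p, false)) ≠ out (D.glue.symm (p, true))

/-- The sign of a crossing by the right-hand rule: it is `+1` when the direction of the
over-strand has to be turned counterclockwise (by less than a half turn) to reach that of the
under-strand, that is for over-strand `3 → 1` and under-strand `0 → 2`, or both reversed. -/
def sign {D : LinkDiagram} (o : D.Orientation) (x : D.Crossing) : ℤ :=
  if o.out (Sum.inr (x, 1)) = o.out (Sum.inr (x, 2)) then 1 else -1

/-- The writhe of an oriented link diagram. -/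
def writhe {D : LinkDiagram} (o : D.Orientation) : ℤ := ∑ x, sign o x

/-- Two cut points are joined in the state `s` by an arc or by a smoothed crossing. At `x` the
state chooses the `A`-smoothing if `s x = true`; it merges the two regions swept by the
over-strand when this is turned counterclockwise, so it joins `0` with `1` and `2` with `3`. The
`B`-smoothing joins `1` with `2` and `3` with `0`. -/
inductive Joined (D : LinkDiagram) (s : D.Crossing → Bool) : D.Point → D.Point → Prop
  | arc (a : D.Arc) : Joined D s (D.arcPt a 0) (D.arcPt a 1)
  | a₁ (x : D.Crossing) (h : s x = true) : Joined D s (D.cornerPt x 0) (D.cornerPt x 1)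
  | a₂ (x : D.Crossing) (h : s x = true) : Joined D s (D.cornerPt x 2) (D.cornerPt x 3)
  | b₁ (x : D.Crossing) (h : s x = false) : Joined D s (D.cornerPt x 1) (D.cornerPt x 2)
  | b₂ (x : D.Crossing) (h : s x = false) : Joined D s (D.cornerPt x 3) (D.cornerPt x 0)

/-- The number of closed curves of a state: `Quot` divides the cut points by the equivalence
relation that `Joined` generates. -/
def loops (D : LinkDiagram) (s : D.Crossing → Bool) : ℕ := Nat.card (Quot (D.Joined s))

/-- The number of `A`-smoothings minus the number of `B`-smoothings of a state. -/
def smoothingIndex (D : LinkDiagram) (s : D.Crossing → Bool) : ℤ :=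
  ∑ x, if s x = true then 1 else -1

/-- The Kauffman bracket in the variable `A = T 1`, with value `1` on a circle without crossings;
a further disjoint circle multiplies it by `-A ^ 2 - A ^ (-2)`. (The diagram is supposed to be
non-empty, so that every state has at least one closed curve.) -/
def bracket (D : LinkDiagram) : ℤ[T;T⁻¹] :=
  ∑ s : D.Crossing → Bool,
    LaurentPolynomial.T (D.smoothingIndex s) *
      (-LaurentPolynomial.T 2 - LaurentPolynomial.T (-2)) ^ (D.loops s - 1)

/-- The normalized bracket `(-A ^ 3) ^ (-w) * ⟨D⟩`, where `w` is the writhe. -/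
def normalizedBracket {D : LinkDiagram} (o : D.Orientation) : ℤ[T;T⁻¹] :=
  LaurentPolynomial.C (((-1 : ℤˣ) ^ writhe o : ℤˣ) : ℤ) *
    LaurentPolynomial.T (-3 * writhe o) * D.bracket

/-- The Jones polynomial `V(t)` of an oriented link diagram, as a Laurent polynomial in the
variable `T 1 = t ^ (1 / 2)`: it arises from the normalized bracket by the substitution
`A = t ^ (-1 / 4)`, so the coefficient of `(t ^ (1 / 2)) ^ k` in `V` is that of `A ^ (-2 * k)` in
the normalized bracket. Odd powers of `A` do not occur there. -/
def jones {D : LinkDiagram} (o : D.Orientation) : ℤ[T;T⁻¹] :=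
  AddMonoidAlgebra.comapDomain (fun k : ℤ => -2 * k) (fun a b h => by simpa using h)
    (normalizedBracket o)

theorem exists_normalizedBracket_eq {D : LinkDiagram} (o : D.Orientation) :
    ∃ g : ℤ[T;T⁻¹], AddMonoidAlgebra.mapDomain (fun k : ℤ => -2 * k) g = normalizedBracket o := by
  let F : ℤ[T;T⁻¹] →+* ℤ[T;T⁻¹] :=
    AddMonoidAlgebra.mapDomainRingHom ℤ (AddMonoidHom.mulLeft (-2 : ℤ))
  have hT : ∀ k : ℤ, Even k → LaurentPolynomial.T k ∈ F.range := by
    rintro k ⟨r, rfl⟩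
    refine ⟨LaurentPolynomial.T (-r), ?_⟩
    change AddMonoidAlgebra.mapDomain (fun k : ℤ => -2 * k) (AddMonoidAlgebra.single (-r) 1) =
      AddMonoidAlgebra.single (r + r) 1
    rw [AddMonoidAlgebra.mapDomain_single]
    congr 1
    ring
  have hC : ∀ u : ℤ, LaurentPolynomial.C u ∈ F.range := fun u => by
    rw [show (LaurentPolynomial.C u : ℤ[T;T⁻¹]) = ((u : ℤ) : ℤ[T;T⁻¹]) by simp]
    exact intCast_mem F.range u
  suffices h : normalizedBracket o ∈ F.range by
    obtain ⟨g, hg⟩ := h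
    exact ⟨g, hg⟩
  unfold normalizedBracket bracket
  rw [Finset.mul_sum]
  refine Subring.sum_mem _ fun s _ => ?_
  rw [← mul_assoc, mul_assoc (LaurentPolynomial.C _), ← LaurentPolynomial.T_add]
  refine mul_mem (mul_mem (hC _) (hT _ ?_)) (pow_mem (sub_mem (neg_mem (hT _ ?_)) (hT _ ?_)) _)
  · unfold writhe smoothingIndex
    rw [Finset.mul_sum, ← Finset.sum_add_distrib]
    refine Finset.even_sum _ fun x _ => ?_
    unfold sign
    split_ifs <;> decide
  · decide
  · decide

/-- The Jones polynomial gives back the normalized bracket when `A ^ (-2)` is substituted for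
`t ^ (1 / 2)`. -/
theorem mapDomain_jones {D : LinkDiagram} (o : D.Orientation) :
    AddMonoidAlgebra.mapDomain (fun k : ℤ => -2 * k) (jones o) = normalizedBracket o := by
  obtain ⟨g, hg⟩ := exists_normalizedBracket_eq o
  have hinj : Function.Injective (fun k : ℤ => -2 * k) := fun a b h => by simpa using h
  have : jones o = g := by
    ext k
    simp only [jones, ← hg]
    exact Finsupp.mapDomain_apply hinj g.coeff k
  rw [this, hg]

end LinkDiagram

/-! ### Braid words and the plat closure -/

/-- A braid on `l` strands, given by a braid word. The letter `(i, true)` is the generator that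
crosses the strands at the positions `i` and `i + 1`, counted from `0` (so it is `σ_{i+1}` if one
counts from `1`); the letter `(i, false)` is the inverse of that generator. -/
abbrev BraidWord (l : ℕ) : Type := List (Fin (l - 1) × Bool)

/-- The plain arcs of the plat closure: at level `k`, the strand at a position `j` that takes no
part in the `k`-th crossing, and a cap or a cup for each pair of neighbouring positions
`2 * j, 2 * j + 1`. -/
inductive PlatArc {m : ℕ} (B : BraidWord (2 * m)) : Type
  | strand (k : Fin B.length) (j : Fin (2 * m))
      (h : (j : ℕ) ≠ B[k].1 ∧ (j : ℕ) ≠ B[k].1 + 1)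
  | cap (j : Fin m)
  | cup (j : Fin m)

/-- The braid is drawn from top to bottom, one crossing per layer. The cut point `(k, j)` lies at
position `j` of the horizontal line above the `k`-th crossing (numbered from `0`); the caps close
the top line, the cups close the bottom line. This function gives the cut point at each end of a
piece; the Boolean is `true` if the piece lies below that cut point and `false` if it lies above.

For the generator, the over-strand runs between top left and bottom right; for its inverse, it runs
between top right and bottom left. -/
def platGlue {m : ℕ} (B : BraidWord (2 * m)) :
    (PlatArc B × Fin 2) ⊕ (Fin B.length × Fin 4) → (Fin (B.length + 1) × Fin (2 * m)) × Bool
  | Sum.inl (PlatArc.strand k j _, e) => if e = 0 then ((k.castSucc, j), true)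
      else ((k.succ, j), false)
  | Sum.inl (PlatArc.cap j, e) => ((0, ⟨2 * j + e, by omega⟩), false)
  | Sum.inl (PlatArc.cup j, e) => ((Fin.last _, ⟨2 * j + e, by omega⟩), true)
  | Sum.inr (k, q) =>
      let topLeft : (Fin (B.length + 1) × Fin (2 * m)) × Bool :=
        ((k.castSucc, ⟨B[k].1, by omega⟩), true)
      let topRight : (Fin (B.length + 1) × Fin (2 * m)) × Bool :=
        ((k.castSucc, ⟨B[k].1 + 1, by omega⟩), true)
      let bottomLeft : (Fin (B.length + 1) × Fin (2 * m)) × Bool :=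
        ((k.succ, ⟨B[k].1, by omega⟩), false)
      let bottomRight : (Fin (B.length + 1) × Fin (2 * m)) × Bool :=
        ((k.succ, ⟨B[k].1 + 1, by omega⟩), false)
      if B[k].2 = true then ![topRight, topLeft, bottomLeft, bottomRight] q
      else ![topLeft, bottomLeft, bottomRight, topRight] q

theorem platGlue_injective {m : ℕ} (B : BraidWord (2 * m)) : Function.Injective (platGlue B) := by
  have mixed : ∀ a e k q, platGlue B (Sum.inl (a, e)) ≠ platGlue B (Sum.inr (k, q)) := by
    intro a e k' q' h
    rcases a with ⟨k, j, hj⟩ | j | j <;> fin_cases e <;> cases hb : B[k'].2 <;> fin_cases q' <;>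
      simp [platGlue, hb, Fin.ext_iff, -Fin.getElem_fin] at h
    all_goals first
      | omega
      | (obtain rfl : k = k' := Fin.ext (by omega)
         omega)
  rintro (⟨a, e⟩ | ⟨k, q⟩) (⟨a', e'⟩ | ⟨k', q'⟩) h
  · rcases a with ⟨k, j, hj⟩ | j | j <;> rcases a' with ⟨k', j', hj'⟩ | j' | j' <;>
      fin_cases e <;> fin_cases e' <;>
      simp [platGlue, Fin.ext_iff] at h ⊢ <;> omega
  · exact absurd h (mixed _ _ _ _)
  · exact absurd h.symm (mixed _ _ _ _)
  · obtain rfl : k = k' := by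
      cases hb : B[k].2 <;> cases hb' : B[k'].2 <;> fin_cases q <;> fin_cases q' <;>
        simp [platGlue, hb, hb', Fin.ext_iff, -Fin.getElem_fin] at h <;>
        exact Fin.ext (by omega)
    cases hb : B[k].2 <;> fin_cases q <;> fin_cases q' <;>
      simp [platGlue, hb, -Fin.getElem_fin] at h ⊢

theorem platGlue_surjective {m : ℕ} (B : BraidWord (2 * m)) :
    Function.Surjective (platGlue B) := by
  rintro ⟨⟨k, j⟩, _ | _⟩
  · refine Fin.cases ?_ (fun k => ?_) k
    · refine ⟨Sum.inl (PlatArc.cap ⟨j / 2, by omega⟩, ⟨j % 2, by omega⟩), ?_⟩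
      simp only [platGlue, Prod.mk.injEq, and_true, true_and, Fin.ext_iff]
      omega
    · by_cases h1 : (j : ℕ) = B[k].1
      · cases hb : B[k].2
        · exact ⟨Sum.inr (k, 1), by simp [platGlue, hb, ← h1, -Fin.getElem_fin]⟩
        · exact ⟨Sum.inr (k, 2), by simp [platGlue, hb, ← h1, -Fin.getElem_fin]⟩
      · by_cases h2 : (j : ℕ) = B[k].1 + 1
        · cases hb : B[k].2
          · exact ⟨Sum.inr (k, 2), by simp [platGlue, hb, ← h2, -Fin.getElem_fin]⟩
          · exact ⟨Sum.inr (k, 3), by simp [platGlue, hb, ← h2, -Fin.getElem_fin]⟩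
        · exact ⟨Sum.inl (PlatArc.strand k j ⟨h1, h2⟩, 1), by simp [platGlue]⟩
  · refine Fin.lastCases ?_ (fun k => ?_) k
    · refine ⟨Sum.inl (PlatArc.cup ⟨j / 2, by omega⟩, ⟨j % 2, by omega⟩), ?_⟩
      simp only [platGlue, Prod.mk.injEq, and_true, true_and, Fin.ext_iff]
      omega
    · by_cases h1 : (j : ℕ) = B[k].1
      · cases hb : B[k].2
        · exact ⟨Sum.inr (k, 0), by simp [platGlue, hb, ← h1, -Fin.getElem_fin]⟩
        · exact ⟨Sum.inr (k, 1), by simp [platGlue, hb, ← h1, -Fin.getElem_fin]⟩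
      · by_cases h2 : (j : ℕ) = B[k].1 + 1
        · cases hb : B[k].2
          · exact ⟨Sum.inr (k, 3), by simp [platGlue, hb, ← h2, -Fin.getElem_fin]⟩
          · exact ⟨Sum.inr (k, 0), by simp [platGlue, hb, ← h2, -Fin.getElem_fin]⟩
        · exact ⟨Sum.inl (PlatArc.strand k j ⟨h1, h2⟩, 0), by simp [platGlue]⟩

/-- The ends of the pieces of the plat closure correspond to the sides of the cut points. -/
def platEquiv {m : ℕ} (B : BraidWord (2 * m)) :
    (PlatArc B × Fin 2) ⊕ (Fin B.length × Fin 4) ≃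
      (Fin (B.length + 1) × Fin (2 * m)) × Bool :=
  Equiv.ofBijective (platGlue B) ⟨platGlue_injective B, platGlue_surjective B⟩

/-- The plat closure of a braid on `2 * m` strands, as a link diagram. -/
abbrev platClosure {m : ℕ} (B : BraidWord (2 * m)) : LinkDiagram where
  Point := Fin (B.length + 1) × Fin (2 * m)
  Arc := PlatArc B
  Crossing := Fin B.length
  glue := platEquiv B

/-- The writhe `w_B` of the braid `B`, seen as part of its plat closure, whose orientation `o`
orients the strands: the sum of the signs of the crossings, where a generator counts `+1` and an
inverse generator `-1` when its two strands run in the same direction (both downwards or both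
upwards), and these signs are reversed when its two strands run in opposite directions. -/
def braidWrithe {m : ℕ} (B : BraidWord (2 * m)) (o : (platClosure B).Orientation) : ℤ :=
  ∑ k : Fin B.length,
    (if B[k].2 = true then 1 else -1) *
      (if o.out ((platEquiv B).symm ((k.castSucc, ⟨B[k].1, by omega⟩), true)) =
          o.out ((platEquiv B).symm ((k.castSucc, ⟨B[k].1 + 1, by omega⟩), true))
        then 1 else -1)

/-! ### The Fibonacci representation -/

/-- Strings of three bits; `true` is `1` and `false` is `0`. -/
abbrev Bits3 : Type := Bool × Bool × Bool

/-- The three-bit strings without two consecutive zeros: `010, 011, 101, 110, 111`. -/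
def IsFib3 (x : Bits3) : Prop := (x.1 || x.2.1) = true ∧ (x.2.1 || x.2.2) = true

instance : DecidablePred IsFib3 := fun x => by unfold IsFib3; infer_instance

/-- The matrix elements of the gate of a braid generator between three-bit strings without two
consecutive zeros. -/
def fibEntry : Bits3 → Bits3 → ℂ
  | (true, false, true), (true, false, true) =>
      (Real.goldenRatio : ℂ)⁻¹ * Complex.exp (4 * Real.pi / 5 * Complex.I)
  | (true, true, true), (true, true, true) => -(Real.goldenRatio : ℂ)⁻¹
  | (false, true, false), (false, true, false) => Complex.exp (-(4 * Real.pi / 5) * Complex.I)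
  | (false, true, true), (false, true, true) => Complex.exp (3 * Real.pi / 5 * Complex.I)
  | (true, true, false), (true, true, false) => Complex.exp (3 * Real.pi / 5 * Complex.I)
  | (true, true, true), (true, false, true) =>
      ((Real.goldenRatio ^ (-(1 / 2) : ℝ) : ℝ) : ℂ) * Complex.exp (-(3 * Real.pi / 5) * Complex.I)
  | (true, false, true), (true, true, true) =>
      ((Real.goldenRatio ^ (-(1 / 2) : ℝ) : ℝ) : ℂ) * Complex.exp (-(3 * Real.pi / 5) * Complex.I)
  | _, _ => 0

/-- The three-qubit gate of a braid generator. On the span of the strings without two consecutive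
zeros it is prescribed; on the span of the other three strings it is any matrix `W` (a choice of
compilation). -/
def fibGate (W : Matrix {x : Bits3 // ¬ IsFib3 x} {x : Bits3 // ¬ IsFib3 x} ℂ) :
    Matrix Bits3 Bits3 ℂ := fun x y =>
  if hx : IsFib3 x then (if IsFib3 y then fibEntry x y else 0)
  else (if hy : IsFib3 y then 0 else W ⟨x, hx⟩ ⟨y, hy⟩)

/-- The operator on `l + 1` qubits, in the computational basis, that applies the three-qubit gate
`G` to the qubits `i, i + 1, i + 2` (the strands `i` and `i + 1` run on the two sides of the qubit
`i + 1`). -/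
def applyGate {l : ℕ} (G : Matrix Bits3 Bits3 ℂ) (i : Fin (l - 1)) :
    Matrix (Fin (l + 1) → Bool) (Fin (l + 1) → Bool) ℂ := fun s t =>
  if ∀ j : Fin (l + 1), (j : ℕ) < i ∨ (i : ℕ) + 2 < j → s j = t j then
    G (s ⟨i, by omega⟩, s ⟨i + 1, by omega⟩, s ⟨i + 2, by omega⟩)
      (t ⟨i, by omega⟩, t ⟨i + 1, by omega⟩, t ⟨i + 2, by omega⟩)
  else 0

/-- The operator `U_B` of a braid word on `l + 1` qubits; an inverse generator is represented by
the conjugate transpose of the gate. -/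
def braidOperator {l : ℕ} (W : Matrix {x : Bits3 // ¬ IsFib3 x} {x : Bits3 // ¬ IsFib3 x} ℂ)
    (B : BraidWord l) : Matrix (Fin (l + 1) → Bool) (Fin (l + 1) → Bool) ℂ :=
  (B.map fun g => applyGate (if g.2 = true then fibGate W else (fibGate W).conjTranspose) g.1).prod

/-- The bit string `0101…10` of length `l + 1` (for even `l`): the bit at position `j`, counted
from `0`, is `1` exactly when `j` is odd. -/
def alphaString (l : ℕ) : Fin (l + 1) → Bool := fun j => decide ((j : ℕ) % 2 = 1)

/-- The square root `e^{6πi/5}` of `t = e^{2πi/5}`. It is `A ^ (-2)` for `A = e^{-3πi/5}`. -/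
def sqrtFifthRoot : ℂˣ :=
  Units.mk0 (Complex.exp (6 * Real.pi / 5 * Complex.I)) (Complex.exp_ne_zero _)

theorem sqrtFifthRoot_sq :
    (sqrtFifthRoot : ℂ) ^ 2 = Complex.exp (2 * Real.pi / 5 * Complex.I) := by
  rw [sqrtFifthRoot, Units.val_mk0, ← Complex.exp_nat_mul,
    show ((2 : ℕ) : ℂ) * (6 * Real.pi / 5 * Complex.I) =
      2 * Real.pi / 5 * Complex.I + 2 * Real.pi * Complex.I by push_cast; ring,
    Complex.exp_add, Complex.exp_two_pi_mul_I, mul_one]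

end

/-!
Let `A = e^{-3πi/5}`. Then `-A² - A⁻² = φ`, and on bit strings without two consecutive zeros the
gate of a braid generator is `A E + A⁻¹`, that of its inverse `A + A⁻¹ E`, where `E` is the
Temperley-Lieb generator in the Fibonacci (RSOS) representation: the bits label the regions between
the strands, and `E` acts on the label between two equal labels (`fibEntry_eq`,
`applyGate_fibGate_mulVec`). A smoothing of a crossing is `E` or the identity in the same way, so
the matrix element of the braid operator and the Kauffman bracket expand into sums over the same
states with the same powers of `A`. It remains to see that a word `w` of generators satisfies
`φ ^ m * ⟨α|w|α⟩ = φ ^ c`, where `c` is the number of closed curves in the plat closure of `w`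
(`goldenRatio_pow_mul_wordMatrix`).

For this, attach to each planar matching `M` of the strands a vector `v M`, supported on the
labellings of the regions of the half plane cut up by the arcs of `M`, with a weight for each arc;
then `E i` maps `v M` to `v (cupCap i M)`, times `φ` if a curve is closed
(`generator_mulVec_matchingVector`). Planarity is what makes the labels and the weights of the new
arcs fit the old ones. The vector of the caps is a multiple of `|α⟩`. Let `E` at the even positions
act last: this multiplies `⟨α|` by `φ ^ m` and turns every matching into that of the caps, so the
matrix element is a power of `φ` whose exponent is purely combinatorial
(`pow_mul_dotProduct_wordMatrix`).

The exponent is identified without following the curves: two-colourings of the points carry another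
representation, with `2` in the place of `φ`, to which the same lemma applies, and there the matrix
element counts the two-colourings of the diagram that are constant along the curves of the state,
of which there are `2 ^ c` (`two_pow_loops`).
-/

noncomputable section

namespace FibonacciPlat

/-! ### Planar matchings -/

/-- The position on the left of the generator `i`. -/
def lft {l : ℕ} (i : Fin (l - 1)) : Fin l := ⟨i, by omega⟩

/-- The position on the right of the generator `i`. -/
def rgt {l : ℕ} (i : Fin (l - 1)) : Fin l := ⟨i + 1, by omega⟩

theorem lft_ne_rgt {l : ℕ} (i : Fin (l - 1)) : lft i ≠ rgt i := by
  simp [lft, rgt]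

/-- A planar perfect matching of `l` points on a line: `M j` is the partner of `j`. -/
structure IsPlanar {l : ℕ} (M : Fin l → Fin l) : Prop where
  invol : ∀ j, M (M j) = j
  ne : ∀ j, M j ≠ j
  noncrossing : ∀ a b, ¬(a < b ∧ b < M a ∧ M a < M b)

/-- The matching obtained from `M` by the Temperley-Lieb generator `i`: the positions `lft i` and
`rgt i` become partners, and so do their former partners. -/
def cupCap {l : ℕ} (i : Fin (l - 1)) (M : Fin l → Fin l) (j : Fin l) : Fin l :=
  if j = lft i then rgt i else if j = rgt i then lft i
  else if M j = lft i then M (rgt i) else if M j = rgt i then M (lft i) else M j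

section
variable {l : ℕ} {M : Fin l → Fin l} {i : Fin (l - 1)}

@[simp] theorem cupCap_lft : cupCap i M (lft i) = rgt i := by simp [cupCap]

@[simp] theorem cupCap_rgt : cupCap i M (rgt i) = lft i := by
  simp [cupCap, (lft_ne_rgt i).symm]

theorem cupCap_of_ne {j : Fin l} (h1 : j ≠ lft i) (h2 : j ≠ rgt i) (h3 : M j ≠ lft i)
    (h4 : M j ≠ rgt i) : cupCap i M j = M j := by simp [cupCap, *]

theorem cupCap_eq_self (hM : IsPlanar M) (h : M (lft i) = rgt i) : cupCap i M = M := by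
  have h' : M (rgt i) = lft i := by rw [← h, hM.invol]
  funext j
  have := hM.invol j
  unfold cupCap
  split_ifs <;> grind

/-- The possible orders of the former partners of two neighbouring positions. -/
theorem IsPlanar.order (hM : IsPlanar M) (h : M (lft i) ≠ rgt i) :
    (M (lft i) < lft i ∧ rgt i < M (rgt i)) ∨
    (rgt i < M (rgt i) ∧ M (rgt i) < M (lft i)) ∨
    (M (rgt i) < M (lft i) ∧ M (lft i) < lft i) := by
  have h1 := hM.noncrossing (lft i) (rgt i)
  have h2 := hM.noncrossing (M (rgt i)) (lft i)
  have h3 := hM.noncrossing (M (rgt i)) (M (lft i))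
  have h5 := hM.noncrossing (M (lft i)) (M (rgt i))
  have h4 := hM.ne (lft i)
  have h6 := hM.ne (rgt i)
  have h7 : M (rgt i) ≠ lft i := fun e => h (by rw [← e, hM.invol])
  have h8 : M (rgt i) ≠ M (lft i) := fun e => lft_ne_rgt i (by
    rw [← hM.invol (lft i), ← e, hM.invol])
  simp only [hM.invol] at h2 h3 h5
  generalize M (lft i) = a at *
  generalize M (rgt i) = b at *
  simp only [lft, rgt, Fin.lt_def, Fin.ext_iff, ne_eq] at *
  omega

theorem cupCap_apply_lft (hM : IsPlanar M) (h : M (lft i) ≠ rgt i) :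
    cupCap i M (M (lft i)) = M (rgt i) := by
  simp [cupCap, h, hM.ne, hM.invol]

theorem cupCap_apply_rgt (hM : IsPlanar M) (h : M (lft i) ≠ rgt i) :
    cupCap i M (M (rgt i)) = M (lft i) := by
  have h7 : M (rgt i) ≠ lft i := fun e => h (by rw [← e, hM.invol])
  simp [cupCap, h7, hM.ne, hM.invol, (lft_ne_rgt i).symm]

/-- Where the position `j` goes under `cupCap i M`. -/
theorem cupCap_cases (hM : IsPlanar M) (h : M (lft i) ≠ rgt i) (j : Fin l) :
    (j = lft i ∧ cupCap i M j = rgt i) ∨ (j = rgt i ∧ cupCap i M j = lft i) ∨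
    (j = M (lft i) ∧ cupCap i M j = M (rgt i)) ∨ (j = M (rgt i) ∧ cupCap i M j = M (lft i)) ∨
    ((j ≠ lft i ∧ j ≠ rgt i ∧ j ≠ M (lft i) ∧ j ≠ M (rgt i)) ∧
      (M j ≠ lft i ∧ M j ≠ rgt i ∧ M j ≠ M (lft i) ∧ M j ≠ M (rgt i)) ∧
      cupCap i M j = M j) := by
  by_cases h1 : j = lft i
  · exact Or.inl ⟨h1, by simp [h1]⟩
  by_cases h2 : j = rgt i
  · exact Or.inr (Or.inl ⟨h2, by simp [h2]⟩)
  by_cases h3 : j = M (lft i)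
  · exact Or.inr (Or.inr (Or.inl ⟨h3, h3 ▸ cupCap_apply_lft hM h⟩))
  by_cases h4 : j = M (rgt i)
  · exact Or.inr (Or.inr (Or.inr (Or.inl ⟨h4, h4 ▸ cupCap_apply_rgt hM h⟩)))
  have inj : Function.Injective M := fun a b e => by rw [← hM.invol a, e, hM.invol]
  have h5 : M j ≠ lft i := fun e => h3 (by rw [← e, hM.invol])
  have h6 : M j ≠ rgt i := fun e => h4 (by rw [← e, hM.invol])
  exact Or.inr (Or.inr (Or.inr (Or.inr ⟨⟨h1, h2, h3, h4⟩, ⟨h5, h6, inj.ne h1, inj.ne h2⟩,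
    cupCap_of_ne h1 h2 h5 h6⟩)))

/-- The arc of a position other than the four affected ones does not cross the new arc between the
former partners: it would have to cross one of the two old arcs. -/
theorem IsPlanar.cupCap_noncrossing (hM : IsPlanar M) (h : M (lft i) ≠ rgt i) (j : Fin l)
    (hj : j ≠ lft i ∧ j ≠ rgt i ∧ j ≠ M (lft i) ∧ j ≠ M (rgt i))
    (hj' : M j ≠ lft i ∧ M j ≠ rgt i ∧ M j ≠ M (lft i) ∧ M j ≠ M (rgt i)) :
    ¬(M (lft i) < j ∧ j < M (rgt i) ∧ M (rgt i) < M j) ∧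
    ¬(M (rgt i) < j ∧ j < M (lft i) ∧ M (lft i) < M j) ∧
    ¬(j < M (lft i) ∧ M (lft i) < M j ∧ M j < M (rgt i)) ∧
    ¬(j < M (rgt i) ∧ M (rgt i) < M j ∧ M j < M (lft i)) := by
  have hv : (rgt i : ℕ) = lft i + 1 := rfl
  have e2 := hM.noncrossing j (lft i)
  have e3 := hM.noncrossing j (rgt i)
  have e4 := hM.noncrossing (lft i) j
  have e5 := hM.noncrossing (rgt i) j
  have e6 := hM.noncrossing (M (lft i)) j
  have e7 := hM.noncrossing (M (rgt i)) j
  have e8 := hM.noncrossing j (M (lft i))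
  have e9 := hM.noncrossing j (M (rgt i))
  rw [hM.invol] at e6 e7 e8 e9
  rcases hM.order h with hord | hord | hord <;> clear h <;>
    simp only [Fin.lt_def, Fin.ext_iff, ne_eq] at * <;> omega

theorem IsPlanar.cupCap (hM : IsPlanar M) : IsPlanar (cupCap i M) := by
  by_cases h : M (lft i) = rgt i
  · rwa [cupCap_eq_self hM h]
  have hord := hM.order h
  have hlr := lft_ne_rgt i
  have hi := hM.invol
  have hn := hM.ne
  refine ⟨fun j => ?_, fun j => ?_, fun a b => ?_⟩
  · unfold FibonacciPlat.cupCap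
    grind
  · unfold FibonacciPlat.cupCap
    grind
  · have hv : (rgt i : ℕ) = lft i + 1 := rfl
    clear hi hn hlr
    rcases cupCap_cases hM h a with ⟨p, q⟩ | ⟨p, q⟩ | ⟨p, q⟩ | ⟨p, q⟩ | ⟨p, p', q⟩
    · rw [p, cupCap_lft]
      simp only [Fin.lt_def]
      omega
    · rw [p, cupCap_rgt]
      simp only [Fin.lt_def]
      omega
    all_goals
      rcases cupCap_cases hM h b with ⟨r, t⟩ | ⟨r, t⟩ | ⟨r, t⟩ | ⟨r, t⟩ | ⟨r, r', t⟩
    all_goals rw [q, t]; clear q t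
    any_goals subst a
    any_goals subst b
    any_goals
      first
      | (simp only [Fin.lt_def, Fin.ext_iff, ne_eq] at *; omega)
      | skip
    · have := (hM.cupCap_noncrossing h b r r').1
      exact this
    · have := (hM.cupCap_noncrossing h b r r').2.1
      exact this
    · have := (hM.cupCap_noncrossing h a p p').2.2.1
      exact this
    · have := (hM.cupCap_noncrossing h a p p').2.2.2
      exact this
    · exact hM.noncrossing a b

/-- If the positions `p, …, q - 1` are matched among themselves, then the labels of the regions
that follow and precede them agree. -/
theorem IsPlanar.label_eq (hM : IsPlanar M) {s : Fin (l + 1) → Bool} (q : ℕ) (hq : q ≤ l) :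
    ∀ p (hp : p ≤ q), (∀ j : Fin l, p ≤ j → (j : ℕ) < q →
      p ≤ M j ∧ (M j : ℕ) < q ∧ s j.castSucc = s (M j).succ) →
      s ⟨p, by omega⟩ = s ⟨q, by omega⟩ := by
  intro p
  induction h : q - p using Nat.strong_induction_on generalizing p with
  | _ n ih =>
    intro hp hcl
    rcases hp.eq_or_lt with rfl | hlt
    · rfl
    obtain ⟨h1, h2, h3⟩ := hcl ⟨p, by omega⟩ le_rfl hlt
    have hstep : s ⟨p, by omega⟩ = s (M ⟨p, by omega⟩).succ := h3
    -- Go from `p` to the region behind its partner.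
    rw [hstep]
    refine ih (q - (M ⟨p, by omega⟩ + 1)) (by omega) (M ⟨p, by omega⟩ + 1) rfl (by omega) ?_
    intro j hj hjq
    obtain ⟨k1, k2, k3⟩ := hcl j (by omega) hjq
    refine ⟨?_, k2, k3⟩
    have c := hM.noncrossing ⟨p, by omega⟩ (M j)
    have e1 := hM.invol j
    have e2 := hM.invol ⟨p, by omega⟩
    have e3 : M j ≠ ⟨p, by omega⟩ := fun e => by rw [← e, e1] at hj; omega
    have e4 : M j ≠ M ⟨p, by omega⟩ := fun e => by
      rw [← e1, e, e2] at hj; simp only at hj; omega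
    rw [e1] at c
    simp only [Fin.lt_def, ne_eq, Fin.ext_iff] at c e3 e4
    omega

end

/-! ### Words of Temperley-Lieb generators -/

/-- The matching obtained from `M` by a word; the letter `(i, true)` is the generator `i`, the
letter `(i, false)` the identity, and the last letter acts first. -/
def wordMatching {l : ℕ} : List (Fin (l - 1) × Bool) → (Fin l → Fin l) → Fin l → Fin l
  | [], M => M
  | (i, true) :: w, M => cupCap i (wordMatching w M)
  | (_, false) :: w, M => wordMatching w M

/-- The number of closed curves split off when a word acts on the matching `M`. -/
def wordLoops {l : ℕ} : List (Fin (l - 1) × Bool) → (Fin l → Fin l) → ℕ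
  | [], _ => 0
  | (i, true) :: w, M =>
      (if wordMatching w M (lft i) = rgt i then 1 else 0) + wordLoops w M
  | (_, false) :: w, M => wordLoops w M

/-- The product of matrices along a word, for matrices `E i` in the place of the generators. -/
def wordMatrix {l : ℕ} {X R : Type*} [Fintype X] [DecidableEq X] [Semiring R]
    (E : Fin (l - 1) → Matrix X X R) (w : List (Fin (l - 1) × Bool)) : Matrix X X R :=
  (w.map fun g => if g.2 = true then E g.1 else 1).prod

/-- The word of the generators at the even positions. -/
def capWord (m : ℕ) : List (Fin (2 * m - 1) × Bool) :=
  List.ofFn fun j : Fin m => (⟨2 * j, by omega⟩, true)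

/-- The matching of the caps and cups of a plat closure. -/
def capMatching (m : ℕ) (j : Fin (2 * m)) : Fin (2 * m) :=
  if h : (j : ℕ) % 2 = 0 then ⟨j + 1, by omega⟩ else ⟨j - 1, by omega⟩

theorem isPlanar_capMatching (m : ℕ) : IsPlanar (capMatching m) := by
  refine ⟨fun j => ?_, fun j => ?_, fun a b => ?_⟩
  · rcases Nat.mod_two_eq_zero_or_one j with h | h
    · have h' : ((j : ℕ) + 1) % 2 ≠ 0 := by omega
      simp [capMatching, h, h']
    · have h' : ((j : ℕ) - 1) % 2 = 0 := by omega
      simp only [capMatching, h, h', one_ne_zero, dite_false, dite_true, Fin.ext_iff]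
      omega
  · unfold capMatching
    split_ifs <;> simp only [ne_eq, Fin.ext_iff] at * <;> omega
  · unfold capMatching
    split_ifs <;> simp only [Fin.lt_def] at * <;> omega

theorem isPlanar_wordMatching {l : ℕ} {M : Fin l → Fin l} (hM : IsPlanar M)
    (w : List (Fin (l - 1) × Bool)) : IsPlanar (wordMatching w M) := by
  induction w with
  | nil => exact hM
  | cons g w ih =>
    obtain ⟨i, _ | _⟩ := g
    · exact ih
    · exact ih.cupCap

theorem wordMatching_append {l : ℕ} (M : Fin l → Fin l) (w w' : List (Fin (l - 1) × Bool)) :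
    wordMatching (w ++ w') M = wordMatching w (wordMatching w' M) := by
  induction w with
  | nil => rfl
  | cons g w ih =>
    obtain ⟨i, _ | _⟩ := g <;> simp [wordMatching, ih]

/-- A generator at an even position is not undone by later generators at even positions. -/
theorem wordMatching_lft_of_even {l : ℕ} {M : Fin l → Fin l} (w : List (Fin (l - 1) × Bool))
    (hw : ∀ g ∈ w, (g.1 : ℕ) % 2 = 0 ∧ g.2 = true) :
    ∀ g ∈ w, wordMatching w M (lft g.1) = rgt g.1 := by
  induction w with
  | nil => simp
  | cons g w ih =>
    obtain ⟨i, b⟩ := g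
    obtain ⟨hi, hb⟩ := hw _ List.mem_cons_self
    simp only at hi hb
    subst hb
    intro g hg
    rcases List.mem_cons.1 hg with rfl | hg'
    · simp [wordMatching]
    have h := ih (fun g hg => hw g (List.mem_cons_of_mem _ hg)) g hg'
    have hge := (hw g hg).1
    by_cases hgi : g.1 = i
    · rw [hgi]; simp [wordMatching]
    have hne : (g.1 : ℕ) ≠ i := fun e => hgi (Fin.ext e)
    rw [wordMatching, cupCap_of_ne, h]
    all_goals (try rw [h]); simp only [lft, rgt, ne_eq, Fin.ext_iff]; omega

theorem wordMatching_capWord {m : ℕ} {M : Fin (2 * m) → Fin (2 * m)} (hM : IsPlanar M) :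
    wordMatching (capWord m) M = capMatching m := by
  have h := wordMatching_lft_of_even (M := M) (capWord m) (by
    intro g hg
    obtain ⟨j, rfl⟩ := (List.mem_ofFn' _ _).1 hg
    simp)
  have hpl := isPlanar_wordMatching hM (capWord m)
  have key : ∀ j : Fin m, wordMatching (capWord m) M ⟨2 * j, by omega⟩ = ⟨2 * j + 1, by omega⟩ :=
    fun j => h (⟨2 * j, by omega⟩, true) ((List.mem_ofFn' _ _).2 ⟨j, rfl⟩)
  funext j
  unfold capMatching
  split_ifs with hj
  · have := key ⟨j / 2, by omega⟩
    convert this using 2 <;> simp only [Fin.ext_iff] <;> omega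
  · have := congrArg (wordMatching (capWord m) M) (key ⟨j / 2, by omega⟩)
    rw [hpl.invol] at this
    convert this.symm using 2 <;> simp only [Fin.ext_iff] <;> omega

section
variable {l : ℕ} {X R : Type*} [Fintype X] [DecidableEq X] [CommSemiring R]
  {E : Fin (l - 1) → Matrix X X R} {v : (Fin l → Fin l) → X → R} {δ : R}

theorem wordMatrix_append (w w' : List (Fin (l - 1) × Bool)) :
    wordMatrix E (w ++ w') = wordMatrix E w * wordMatrix E w' := by
  simp [wordMatrix]

/-- In a representation with vectors `v M` that the generators permute up to the value `δ` of a
closed curve, a word multiplies them by a power of `δ` that depends on the word only. -/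
theorem wordMatrix_mulVec
    (hv : ∀ i M, IsPlanar M →
      (E i).mulVec (v M) = (if M (lft i) = rgt i then δ else 1) • v (cupCap i M))
    {M : Fin l → Fin l} (hM : IsPlanar M) (w : List (Fin (l - 1) × Bool)) :
    (wordMatrix E w).mulVec (v M) = δ ^ wordLoops w M • v (wordMatching w M) := by
  induction w with
  | nil => simp [wordMatrix, wordLoops, wordMatching]
  | cons g w ih =>
    obtain ⟨i, _ | _⟩ := g
    · simpa [wordMatrix, wordLoops, wordMatching] using ih
    · have : wordMatrix E ((i, true) :: w) = E i * wordMatrix E w := by simp [wordMatrix]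
      rw [this, ← Matrix.mulVec_mulVec, ih, Matrix.mulVec_smul,
        hv i _ (isPlanar_wordMatching hM w), smul_smul, wordLoops, wordMatching, pow_add,
        mul_comm]
      congr 2
      split_ifs <;> simp

end

theorem vecMul_wordMatrix_capWord {m : ℕ} {X R : Type*} [Fintype X] [DecidableEq X]
    [CommSemiring R] {E : Fin (2 * m - 1) → Matrix X X R} {δ : R} {c : X → R}
    (hc : ∀ i : Fin (2 * m - 1), (i : ℕ) % 2 = 0 → Matrix.vecMul c (E i) = δ • c) :
    Matrix.vecMul c (wordMatrix E (capWord m)) = δ ^ m • c := by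
  have aux : ∀ w : List (Fin (2 * m - 1) × Bool),
      (∀ g ∈ w, (g.1 : ℕ) % 2 = 0 ∧ g.2 = true) →
      Matrix.vecMul c (wordMatrix E w) = δ ^ w.length • c := by
    intro w
    induction w with
    | nil => simp [wordMatrix]
    | cons g w ih =>
      intro hw
      obtain ⟨h1, h2⟩ := hw g List.mem_cons_self
      have : wordMatrix E (g :: w) = E g.1 * wordMatrix E w := by simp [wordMatrix, h2]
      rw [this, ← Matrix.vecMul_vecMul, hc _ h1, Matrix.smul_vecMul,
        ih fun g hg => hw g (List.mem_cons_of_mem _ hg), smul_smul, List.length_cons, pow_succ']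
  rw [aux]
  · simp [capWord]
  · intro g hg
    obtain ⟨j, rfl⟩ := (List.mem_ofFn' _ _).1 hg
    simp

/-- The exponent in the plat closure of a word, the same for every value of `δ`: closing the word
by the generators at the even positions turns any matching into the matching of the caps. -/
theorem pow_mul_dotProduct_wordMatrix {m : ℕ} {X R : Type*} [Fintype X] [DecidableEq X]
    [CommSemiring R] {E : Fin (2 * m - 1) → Matrix X X R}
    {v : (Fin (2 * m) → Fin (2 * m)) → X → R} {δ : R} {c : X → R}
    (hv : ∀ i M, IsPlanar M →
      (E i).mulVec (v M) = (if M (lft i) = rgt i then δ else 1) • v (cupCap i M))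
    (hc : ∀ i : Fin (2 * m - 1), (i : ℕ) % 2 = 0 → Matrix.vecMul c (E i) = δ • c)
    (w : List (Fin (2 * m - 1) × Bool)) :
    δ ^ m * c ⬝ᵥ (wordMatrix E w).mulVec (v (capMatching m)) =
      δ ^ wordLoops (capWord m ++ w) (capMatching m) * c ⬝ᵥ v (capMatching m) := by
  have hcap := isPlanar_capMatching m
  rw [← smul_eq_mul, ← smul_dotProduct, ← vecMul_wordMatrix_capWord hc,
    ← Matrix.dotProduct_mulVec, Matrix.mulVec_mulVec, ← wordMatrix_append,
    wordMatrix_mulVec hv hcap, wordMatching_append,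
    wordMatching_capWord (isPlanar_wordMatching hcap w), dotProduct_smul, smul_eq_mul]

/-! ### The Fibonacci representation of the Temperley-Lieb generators -/

/-- The fourth root of the quantum dimension of a label: the dimension is `φ` for the bit `1` and
`1` for the bit `0`. -/
def dimRoot (b : Bool) : ℂ := if b = true then ((Real.goldenRatio ^ (1 / 4 : ℝ) : ℝ) : ℂ) else 1

theorem dimRoot_false : dimRoot false = 1 := rfl

theorem dimRoot_ne_zero (b : Bool) : dimRoot b ≠ 0 := by
  cases b
  · simp [dimRoot]
  · simp only [dimRoot, if_true, ne_eq, Complex.ofReal_eq_zero]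
    exact (Real.rpow_pos_of_pos Real.goldenRatio_pos _).ne'

theorem dimRoot_true_pow_four : dimRoot true ^ 4 = (Real.goldenRatio : ℂ) := by
  simp only [dimRoot, if_true]
  norm_cast
  rw [← Real.rpow_natCast, ← Real.rpow_mul Real.goldenRatio_pos.le]
  norm_num

/-- The sum of the dimensions of the labels that may stand next to a label `x` is `φ` times the
dimension of `x`. -/
theorem sum_dimRoot_pow_four (x : Bool) :
    ∑ y : Bool, (if (x || y) = true then dimRoot y ^ 4 else 0) =
      Real.goldenRatio * dimRoot x ^ 4 := by
  cases x
  · simp [dimRoot_true_pow_four, dimRoot_false]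
  · simp only [Bool.true_or, if_true, Fintype.sum_bool, dimRoot_true_pow_four, dimRoot_false]
    have := Real.goldenRatio_sq
    rw [← sq, ← Complex.ofReal_pow, this]
    simp

/-- The three-qubit matrix of a Temperley-Lieb generator: it acts on the middle label, between two
equal labels `x`, as the multiple by `φ` of a projection onto a line. -/
def generatorEntry : Matrix Bits3 Bits3 ℂ := fun x y =>
  if IsFib3 x ∧ IsFib3 y ∧ x.1 = x.2.2 ∧ y.1 = x.1 ∧ y.2.2 = x.2.2 then
    dimRoot x.2.1 ^ 2 * dimRoot y.2.1 ^ 2 / dimRoot x.1 ^ 4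
  else 0

/-- The region between the strands of the generator `i`, as a label position. -/
def mid {l : ℕ} (i : Fin (l - 1)) : Fin (l + 1) := (lft i).succ

section
variable {l : ℕ} {M : Fin l → Fin l} {i : Fin (l - 1)} {s : Fin (l + 1) → Bool}

theorem castSucc_eq_mid {j : Fin l} : j.castSucc = mid i ↔ j = rgt i := by
  simp [mid, lft, rgt, Fin.ext_iff]

theorem succ_eq_mid {j : Fin l} : j.succ = mid i ↔ j = lft i := by
  simp [mid]

theorem applyGate_generatorEntry_mulVec (u : (Fin (l + 1) → Bool) → ℂ) :
    (applyGate generatorEntry i).mulVec u s =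
      ∑ y : Bool, generatorEntry (s (lft i).castSucc, s (mid i), s (rgt i).succ)
        (s (lft i).castSucc, y, s (rgt i).succ) * u (Function.update s (mid i) y) := by
  have hl : (lft i).castSucc ≠ mid i := by simp [castSucc_eq_mid, lft_ne_rgt]
  have hr : (rgt i).succ ≠ mid i := by simp [succ_eq_mid, (lft_ne_rgt i).symm]
  symm
  refine Fintype.sum_of_injective (fun y => Function.update s (mid i) y)
    (Function.update_injective s (mid i)) _ _ ?_ ?_
  · intro t ht
    by_contra hne
    apply ht
    refine ⟨t (mid i), ?_⟩
    have h0 := left_ne_zero_of_mul hne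
    simp only [applyGate, generatorEntry, ne_eq, ite_eq_right_iff, Classical.not_imp] at h0
    obtain ⟨h1, ⟨-, -, -, h2, h3⟩, -⟩ := h0
    funext j
    by_cases hj : j = mid i
    · subst hj; simp
    simp only [Function.update_of_ne hj]
    by_cases hj1 : j = (lft i).castSucc
    · rw [hj1]; exact h2.symm
    by_cases hj2 : j = (rgt i).succ
    · rw [hj2]; exact h3.symm
    refine h1 j ?_
    simp only [Fin.ext_iff, mid, lft, rgt, Fin.val_succ, Fin.val_castSucc] at hj hj1 hj2
    omega
  · intro y
    congr 1
    have h : ∀ j : Fin (l + 1), (j : ℕ) < i ∨ (i : ℕ) + 2 < j →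
        s j = Function.update s (mid i) y j := by
      intro j hj
      rw [Function.update_of_ne]
      simp only [ne_eq, Fin.ext_iff, mid, lft, Fin.val_succ]
      omega
    refine Eq.trans ?_ (if_pos h).symm
    congr 1
    change _ = (Function.update s (mid i) y (lft i).castSucc, Function.update s (mid i) y (mid i),
      Function.update s (mid i) y (rgt i).succ)
    rw [Function.update_of_ne hl, Function.update_of_ne hr, Function.update_self]

/-- A labelling of the `l + 1` regions between and beside `l` points by bits which labels the first
region by `0`, has no two neighbouring zeros, and gives equal labels to the two ends of a region
that passes along an arc of `M`. -/
def IsLabelling (M : Fin l → Fin l) (s : Fin (l + 1) → Bool) : Prop :=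
  s 0 = false ∧ (∀ j : Fin l, (s j.castSucc || s j.succ) = true) ∧
    ∀ j : Fin l, s j.castSucc = s (M j).succ

/-- The weight of the end `j` of an arc of `M`: the fourth root of the quotient of the dimensions
of the labels inside and outside the arc. -/
def endWeight (M : Fin l → Fin l) (s : Fin (l + 1) → Bool) (j : Fin l) : ℂ :=
  if j < M j then dimRoot (s j.succ) / dimRoot (s j.castSucc)
  else dimRoot (s j.castSucc) / dimRoot (s j.succ)

open Classical in
/-- The vector of a planar matching in the Fibonacci representation. -/
def matchingVector (M : Fin l → Fin l) (s : Fin (l + 1) → Bool) : ℂ :=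
  if IsLabelling M s then ∏ j, endWeight M s j else 0

/-- The condition for the matrix element of the generator `i` between the labelling `s` and the one
with `y` in the middle region not to vanish. -/
def GeneratorCond (i : Fin (l - 1)) (s : Fin (l + 1) → Bool) (y : Bool) : Prop :=
  s (lft i).castSucc = s (rgt i).succ ∧ (s (lft i).castSucc || s (mid i)) = true ∧
    (s (lft i).castSucc || y) = true

open Classical in
theorem applyGate_generatorEntry_mulVec_matchingVector :
    (applyGate generatorEntry i).mulVec (matchingVector M) s =
      ∑ y : Bool, if GeneratorCond i s y ∧ IsLabelling M (Function.update s (mid i) y) then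
        dimRoot (s (mid i)) ^ 2 * dimRoot y ^ 2 / dimRoot (s (lft i).castSucc) ^ 4 *
          ∏ j, endWeight M (Function.update s (mid i) y) j
      else 0 := by
  rw [applyGate_generatorEntry_mulVec]
  refine Finset.sum_congr rfl fun y _ => ?_
  have : (IsFib3 (s (lft i).castSucc, s (mid i), s (rgt i).succ) ∧
      IsFib3 (s (lft i).castSucc, y, s (rgt i).succ) ∧
      s (lft i).castSucc = s (rgt i).succ) ↔ GeneratorCond i s y := by
    simp only [IsFib3, GeneratorCond]
    generalize s (lft i).castSucc = a
    generalize s (rgt i).succ = b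
    generalize s (mid i) = c
    revert a b c y
    decide
  simp only [generatorEntry, matchingVector, and_true, this]
  split_ifs <;> simp_all

theorem update_mid_castSucc {y : Bool} {j : Fin l} (hj : j ≠ rgt i) :
    Function.update s (mid i) y j.castSucc = s j.castSucc :=
  Function.update_of_ne (by rwa [ne_eq, castSucc_eq_mid]) _ _

theorem update_mid_succ {y : Bool} {j : Fin l} (hj : j ≠ lft i) :
    Function.update s (mid i) y j.succ = s j.succ :=
  Function.update_of_ne (by rwa [ne_eq, succ_eq_mid]) _ _

theorem update_mid_rgt {y : Bool} : Function.update s (mid i) y (rgt i).castSucc = y := by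
  rw [castSucc_eq_mid.2 rfl, Function.update_self]

theorem update_mid_lft {y : Bool} : Function.update s (mid i) y (lft i).succ = y := by
  rw [succ_eq_mid.2 rfl, Function.update_self]

theorem update_mid_zero {y : Bool} : Function.update s (mid i) y 0 = s 0 :=
  Function.update_of_ne (by simp [mid, Fin.ext_iff]) _ _

theorem castSucc_rgt_eq : (rgt i).castSucc = mid i := castSucc_eq_mid.2 rfl

/-- In a labelling of the joined matching, the region between the strands of the generator and the
arc next to it has one label on both sides: the points in between are matched among themselves. -/
theorem label_succ_apply_lft (hM : IsPlanar M) (h : M (lft i) ≠ rgt i)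
    (hs : IsLabelling (cupCap i M) s) : s (M (lft i)).succ = s (lft i).castSucc := by
  obtain ⟨-, -, hs⟩ := hs
  have h1 : s (lft i).castSucc = s (rgt i).succ := by simpa using hs (lft i)
  have h2 : s (M (rgt i)).castSucc = s (M (lft i)).succ := by
    simpa [cupCap_apply_rgt hM h] using hs (M (rgt i))
  have hlr : (rgt i : ℕ) = lft i + 1 := rfl
  -- Below an arc that ends at the generator, all other positions are matched among themselves.
  have hin : ∀ p q : Fin l, M p = q → p < q →
      (q = lft i ∨ p = rgt i) → ∀ j : Fin l, p < j → j < q → j ≠ M (lft i) → j ≠ M (rgt i) →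
      p < M j ∧ M j < q ∧ s j.castSucc = s (M j).succ := by
    intro p q hpq hlt hor j hpj hjq hA hB
    have c1 := hM.noncrossing p j
    have c2 := hM.noncrossing (M j) p
    rw [hM.invol, hpq] at c2
    rw [hpq] at c1
    have inj : Function.Injective M := fun a b e => by rw [← hM.invol a, e, hM.invol]
    have n1 : M j ≠ q := hpq ▸ inj.ne hpj.ne'
    have n2 : M j ≠ p := fun e => hjq.ne (by rw [← hpq, ← e, hM.invol])
    have n3 : j ≠ lft i ∧ j ≠ rgt i := by
      simp only [Fin.lt_def, Fin.ext_iff, ne_eq] at *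
      omega
    have n4 := hs j
    rw [cupCap_of_ne n3.1 n3.2 (fun e => hA (by rw [← e, hM.invol]))
      (fun e => hB (by rw [← e, hM.invol]))] at n4
    refine ⟨?_, ?_, n4⟩ <;> simp only [Fin.lt_def, Fin.ext_iff, ne_eq] at * <;> omega
  rcases hM.order h with ⟨o1, o2⟩ | ⟨o1, o2⟩ | ⟨o1, o2⟩
  · refine hM.label_eq (lft i) (by omega) (M (lft i) + 1) o1 fun j hj1 hj2 => ?_
    have := hin (M (lft i)) (lft i) (hM.invol _) o1 (Or.inl rfl) j hj1 hj2
      (Fin.ne_of_gt hj1) (by simp only [Fin.lt_def, Fin.ext_iff, ne_eq] at *; omega)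
    exact this
  · rw [← h2, h1]
    symm
    refine hM.label_eq (M (rgt i)) (by omega) (rgt i + 1) o1 fun j hj1 hj2 => ?_
    have := hin (rgt i) (M (rgt i)) rfl o1 (Or.inr rfl) j hj1 hj2
      (by simp only [Fin.lt_def, Fin.ext_iff, ne_eq] at *; omega) (Fin.ne_of_lt hj2)
    exact this
  · refine hM.label_eq (lft i) (by omega) (M (lft i) + 1) o2 fun j hj1 hj2 => ?_
    have := hin (M (lft i)) (lft i) (hM.invol _) o2 (Or.inl rfl) j hj1 hj2
      (Fin.ne_of_gt hj1) (by simp only [Fin.lt_def, Fin.ext_iff, ne_eq] at *; omega)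
    exact this

theorem isLabelling_update_iff_of_eq {y : Bool} (hM : IsPlanar M) (h : M (lft i) = rgt i) :
    GeneratorCond i s y ∧ IsLabelling M (Function.update s (mid i) y) ↔
      IsLabelling M s ∧ (s (lft i).castSucc || y) = true := by
  have h' : M (rgt i) = lft i := by rw [← h, hM.invol]
  have hlr := lft_ne_rgt i
  constructor
  · rintro ⟨⟨h1, h2, h3⟩, h4, h5, h6⟩
    refine ⟨⟨by rwa [update_mid_zero] at h4, fun j => ?_, fun j => ?_⟩, h3⟩
    · by_cases hj : j = lft i
      · rw [hj]; exact h2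
      by_cases hj' : j = rgt i
      · rw [hj', castSucc_rgt_eq, ← h1, Bool.or_comm]; exact h2
      have := h5 j
      rwa [update_mid_castSucc hj', update_mid_succ hj] at this
    · by_cases hj : j = lft i
      · rw [hj, h]; exact h1
      by_cases hj' : j = rgt i
      · rw [hj', h', castSucc_rgt_eq]; rfl
      have := h6 j
      rwa [update_mid_castSucc hj', update_mid_succ fun e => hj' (by rw [← h, ← e, hM.invol])]
        at this
  · rintro ⟨⟨h4, h5, h6⟩, h3⟩
    have h1 : s (lft i).castSucc = s (rgt i).succ := by rw [h6, h]
    refine ⟨⟨h1, h5 (lft i), h3⟩, by rwa [update_mid_zero], fun j => ?_, fun j => ?_⟩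
    · by_cases hj : j = lft i
      · rw [hj, update_mid_lft, update_mid_castSucc hlr]; exact h3
      by_cases hj' : j = rgt i
      · rw [hj', update_mid_rgt, update_mid_succ hlr.symm, ← h1, Bool.or_comm]; exact h3
      rw [update_mid_castSucc hj', update_mid_succ hj]; exact h5 j
    · by_cases hj : j = lft i
      · rw [hj, h, update_mid_castSucc hlr, update_mid_succ hlr.symm]; exact h1
      by_cases hj' : j = rgt i
      · rw [hj', h', update_mid_rgt, update_mid_lft]
      rw [update_mid_castSucc hj', update_mid_succ fun e => hj' (by rw [← h, ← e, hM.invol])]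
      exact h6 j

theorem isLabelling_update_iff_of_ne {y : Bool} (hM : IsPlanar M) (h : M (lft i) ≠ rgt i) :
    GeneratorCond i s y ∧ IsLabelling M (Function.update s (mid i) y) ↔
      IsLabelling (cupCap i M) s ∧ y = s (M (lft i)).castSucc := by
  have hlr := lft_ne_rgt i
  have hA := hM.ne (lft i)
  have hB := hM.ne (rgt i)
  have hB' : M (rgt i) ≠ lft i := fun e => h (by rw [← e, hM.invol])
  constructor
  · rintro ⟨⟨h1, h2, h3⟩, h4, h5, h6⟩
    have k1 := h6 (lft i)
    have k2 := h6 (rgt i)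
    have k3 := h6 (M (lft i))
    have k4 := h6 (M (rgt i))
    rw [update_mid_castSucc hlr, update_mid_succ hA] at k1
    rw [update_mid_rgt, update_mid_succ hB'] at k2
    rw [update_mid_castSucc h, hM.invol, update_mid_lft] at k3
    rw [update_mid_castSucc hB, hM.invol, update_mid_succ hlr.symm] at k4
    refine ⟨⟨by rwa [update_mid_zero] at h4, fun j => ?_, fun j => ?_⟩, k3.symm⟩
    · by_cases hj : j = lft i
      · rw [hj]; exact h2
      by_cases hj' : j = rgt i
      · rw [hj', castSucc_rgt_eq, ← h1, Bool.or_comm]; exact h2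
      have := h5 j
      rwa [update_mid_castSucc hj', update_mid_succ hj] at this
    · rcases cupCap_cases hM h j with ⟨p, q⟩ | ⟨p, q⟩ | ⟨p, q⟩ | ⟨p, q⟩ | ⟨p, p', q⟩ <;> rw [q]
      · rw [p]; exact h1
      · rw [p, castSucc_rgt_eq]; rfl
      · rw [p, k3, k2]
      · rw [p, k4, ← k1, h1]
      · have := h6 j
        rwa [update_mid_castSucc p.2.1, update_mid_succ p'.1] at this
  · rintro ⟨hs, rfl⟩
    have k1 := label_succ_apply_lft hM h hs
    obtain ⟨h4, h5, h6⟩ := hs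
    have h1 : s (lft i).castSucc = s (rgt i).succ := by simpa using h6 (lft i)
    have k2 : s (M (rgt i)).castSucc = s (M (lft i)).succ := by
      simpa [cupCap_apply_rgt hM h] using h6 (M (rgt i))
    have k3 : s (M (lft i)).castSucc = s (M (rgt i)).succ := by
      simpa [cupCap_apply_lft hM h] using h6 (M (lft i))
    have h3 : (s (lft i).castSucc || s (M (lft i)).castSucc) = true := by
      rw [← k1, Bool.or_comm]; exact h5 _
    refine ⟨⟨h1, h5 (lft i), h3⟩, by rwa [update_mid_zero], fun j => ?_, fun j => ?_⟩
    · by_cases hj : j = lft i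
      · rw [hj, update_mid_lft, update_mid_castSucc hlr]; exact h3
      by_cases hj' : j = rgt i
      · rw [hj', update_mid_rgt, update_mid_succ hlr.symm, ← h1, Bool.or_comm]; exact h3
      rw [update_mid_castSucc hj', update_mid_succ hj]; exact h5 j
    · rcases cupCap_cases hM h j with ⟨p, q⟩ | ⟨p, q⟩ | ⟨p, q⟩ | ⟨p, q⟩ | ⟨p, p', q⟩
      · rw [p, update_mid_castSucc hlr, update_mid_succ hA, k1]
      · rw [p, update_mid_rgt, update_mid_succ hB', k3]
      · rw [p, hM.invol, update_mid_castSucc h, update_mid_lft]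
      · rw [p, hM.invol, update_mid_castSucc hB, update_mid_succ hlr.symm, k2, k1, h1]
      · have := h6 j
        rw [q] at this
        rwa [update_mid_castSucc p.2.1, update_mid_succ p'.1]

theorem prod_endWeight_of_eq {y : Bool} (hM : IsPlanar M) (h : M (lft i) = rgt i)
    (hs : IsLabelling M s) :
    dimRoot (s (mid i)) ^ 2 * dimRoot y ^ 2 / dimRoot (s (lft i).castSucc) ^ 4 *
        ∏ j, endWeight M (Function.update s (mid i) y) j =
      dimRoot y ^ 4 / dimRoot (s (lft i).castSucc) ^ 4 * ∏ j, endWeight M s j := by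
  have h' : M (rgt i) = lft i := by rw [← h, hM.invol]
  have hlr := lft_ne_rgt i
  have hlt : lft i < rgt i := by simp [lft, rgt]
  have h1 : s (rgt i).succ = s (lft i).castSucc := by rw [hs.2.2, h]
  rw [← Finset.prod_mul_prod_compl {lft i, rgt i},
    ← Finset.prod_mul_prod_compl {lft i, rgt i} (endWeight M s),
    Finset.prod_pair hlr, Finset.prod_pair hlr]
  have hcompl : ∏ j ∈ ({lft i, rgt i} : Finset (Fin l))ᶜ,
      endWeight M (Function.update s (mid i) y) j =
      ∏ j ∈ ({lft i, rgt i} : Finset (Fin l))ᶜ, endWeight M s j := by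
    refine Finset.prod_congr rfl fun j hj => ?_
    simp only [Finset.mem_compl, Finset.mem_insert, Finset.mem_singleton, not_or] at hj
    rw [endWeight, endWeight, update_mid_castSucc hj.2, update_mid_succ hj.1]
  rw [hcompl]
  clear hcompl
  generalize ∏ j ∈ _ᶜ, endWeight _ s j = c
  simp only [endWeight, h, h', hlt, hlt.not_gt, if_true, if_false, update_mid_lft,
    update_mid_castSucc hlr, update_mid_succ hlr.symm, h1, castSucc_rgt_eq, Function.update_self]
  rw [show (lft i).succ = mid i from rfl]
  have e1 := dimRoot_ne_zero (s (mid i))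
  have e2 := dimRoot_ne_zero y
  have e3 := dimRoot_ne_zero (s (lft i).castSucc)
  field_simp

/-- The weights of the four affected ends change under the joining of two arcs as the matrix
element of the generator does. -/
theorem prod_endWeight_of_ne (hM : IsPlanar M) (h : M (lft i) ≠ rgt i)
    (hs : IsLabelling (cupCap i M) s) :
    dimRoot (s (mid i)) ^ 2 * dimRoot (s (M (lft i)).castSucc) ^ 2 /
        dimRoot (s (lft i).castSucc) ^ 4 *
        ∏ j, endWeight M (Function.update s (mid i) (s (M (lft i)).castSucc)) j =
      ∏ j, endWeight (cupCap i M) s j := by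
  have hlr := lft_ne_rgt i
  have hlt : lft i < rgt i := by simp [lft, rgt]
  have hA := hM.ne (lft i)
  have hB := hM.ne (rgt i)
  have hB' : M (rgt i) ≠ lft i := fun e => h (by rw [← e, hM.invol])
  have hAB : M (lft i) ≠ M (rgt i) := fun e => hlr (by rw [← hM.invol (lft i), e, hM.invol])
  have k1 := label_succ_apply_lft hM h hs
  have h1 : s (rgt i).succ = s (lft i).castSucc := by simpa using (hs.2.2 (lft i)).symm
  have k2 : s (M (rgt i)).castSucc = s (lft i).castSucc := by
    simpa [cupCap_apply_rgt hM h, k1] using hs.2.2 (M (rgt i))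
  have k3 : s (M (rgt i)).succ = s (M (lft i)).castSucc := by
    simpa [cupCap_apply_lft hM h] using (hs.2.2 (M (lft i))).symm
  -- Only the ends `lft i`, `rgt i` and those of their former partners change their weights.
  let S : Finset (Fin l) := {lft i, rgt i, M (lft i), M (rgt i)}
  have hS : ∀ f : Fin l → ℂ, ∏ j, f j =
      f (lft i) * (f (rgt i) * (f (M (lft i)) * f (M (rgt i)))) * ∏ j ∈ Sᶜ, f j := by
    intro f
    rw [← Finset.prod_mul_prod_compl S]
    congr 1
    rw [Finset.prod_insert, Finset.prod_insert, Finset.prod_pair hAB]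
    · simp [h.symm, hB.symm]
    · simp [hlr, hA.symm, hB'.symm]
  rw [hS, hS (endWeight (cupCap i M) s)]
  have hcompl : ∏ j ∈ Sᶜ,
      endWeight M (Function.update s (mid i) (s (M (lft i)).castSucc)) j =
      ∏ j ∈ Sᶜ, endWeight (cupCap i M) s j := by
    refine Finset.prod_congr rfl fun j hj => ?_
    simp only [S, Finset.mem_compl, Finset.mem_insert, Finset.mem_singleton, not_or] at hj
    rw [endWeight, endWeight, update_mid_castSucc hj.2.1, update_mid_succ hj.1,
      cupCap_of_ne hj.1 hj.2.1 (fun e => hj.2.2.1 (by rw [← e, hM.invol]))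
        (fun e => hj.2.2.2 (by rw [← e, hM.invol]))]
  rw [hcompl]
  clear hcompl
  generalize ∏ j ∈ _ᶜ, endWeight _ s j = c
  simp only [endWeight, hM.invol, cupCap_lft, cupCap_rgt, cupCap_apply_lft hM h,
    cupCap_apply_rgt hM h, hlt, hlt.not_gt, if_true, if_false, update_mid_lft,
    update_mid_castSucc hlr, update_mid_succ hlr.symm, update_mid_castSucc h, update_mid_succ hA,
    update_mid_castSucc hB, update_mid_succ hB', h1, castSucc_rgt_eq, k1, k2, k3,
    Function.update_self]
  rw [show (lft i).succ = mid i from rfl]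
  have e1 := dimRoot_ne_zero (s (mid i))
  have e2 := dimRoot_ne_zero (s (M (lft i)).castSucc)
  have e3 := dimRoot_ne_zero (s (lft i).castSucc)
  rcases hM.order h with ⟨o1, o2⟩ | ⟨o1, o2⟩ | ⟨o1, o2⟩
  · have o3 : M (lft i) < M (rgt i) := o1.trans (hlt.trans o2)
    simp only [o1, o1.not_gt, o2, o2.not_gt, o3, o3.not_gt, if_true, if_false]
    field_simp
  · have o3 : lft i < M (lft i) := hlt.trans (o1.trans o2)
    simp only [o1, o1.not_gt, o2, o2.not_gt, o3, o3.not_gt, if_true, if_false]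
    field_simp
  · have o3 : M (rgt i) < rgt i := o1.trans (o2.trans hlt)
    simp only [o1, o1.not_gt, o2, o2.not_gt, o3, o3.not_gt, if_true, if_false]
    field_simp

theorem generator_mulVec_matchingVector (i : Fin (l - 1)) (M : Fin l → Fin l) (hM : IsPlanar M) :
    (applyGate generatorEntry i).mulVec (matchingVector M) =
      (if M (lft i) = rgt i then (Real.goldenRatio : ℂ) else 1) •
        matchingVector (cupCap i M) := by
  classical
  funext s
  rw [applyGate_generatorEntry_mulVec_matchingVector, Pi.smul_apply, smul_eq_mul]
  split_ifs with h
  · rw [cupCap_eq_self hM h]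
    simp only [isLabelling_update_iff_of_eq hM h]
    rw [matchingVector]
    split_ifs with hs
    · simp only [hs, true_and, prod_endWeight_of_eq hM h hs]
      rw [← mul_div_cancel_right₀ (Real.goldenRatio : ℂ)
        (pow_ne_zero 4 (dimRoot_ne_zero (s (lft i).castSucc))), ← sum_dimRoot_pow_four,
        Finset.sum_div, Finset.sum_mul]
      refine Finset.sum_congr rfl fun y _ => ?_
      split_ifs <;> simp
    · simp [hs]
  · simp only [isLabelling_update_iff_of_ne hM h, one_mul]
    rw [matchingVector]
    split_ifs with hs
    · simp only [hs, true_and, Finset.sum_ite_eq', Finset.mem_univ, if_true]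
      exact prod_endWeight_of_ne hM h hs
    · simp [hs]

end

/-! ### Counting closed curves by two-colourings -/

section
variable {l : ℕ} {M : Fin l → Fin l} {i : Fin (l - 1)}

/-- The indicator of the two-colourings of the points that are constant along the arcs of `M`. -/
def colourVector (M : Fin l → Fin l) (f : Fin l → Bool) : ℕ := if ∀ j, f (M j) = f j then 1 else 0

/-- Two-colourings of the points above and below the generator `i` that are constant along its
arcs. -/
def ColourRel (i : Fin (l - 1)) (f g : Fin l → Bool) : Prop :=
  f (lft i) = f (rgt i) ∧ g (lft i) = g (rgt i) ∧ ∀ j, j ≠ lft i → j ≠ rgt i → f j = g j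

instance (i : Fin (l - 1)) (f g : Fin l → Bool) : Decidable (ColourRel i f g) := by
  unfold ColourRel; infer_instance

/-- The matrix of the generator `i` on two-colourings of the points. -/
def colourMatrix (i : Fin (l - 1)) : Matrix (Fin l → Bool) (Fin l → Bool) ℕ := fun f g =>
  if ColourRel i f g then 1 else 0

theorem colourMatrix_transpose (i : Fin (l - 1)) : (colourMatrix i).transpose = colourMatrix i := by
  ext f g
  simp only [Matrix.transpose_apply, colourMatrix]
  congr 1
  simp only [ColourRel, eq_iff_iff]
  constructor <;> exact fun ⟨h1, h2, h3⟩ => ⟨h2, h1, fun j a b => (h3 j a b).symm⟩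

/-- The colouring `f` with the colours at `lft i` and `rgt i` replaced by `c`. -/
def recolour (i : Fin (l - 1)) (f : Fin l → Bool) (c : Bool) (j : Fin l) : Bool :=
  if j = lft i ∨ j = rgt i then c else f j

theorem colourMatrix_mulVec (u : (Fin l → Bool) → ℕ) (f : Fin l → Bool) :
    (colourMatrix i).mulVec u f =
      if f (lft i) = f (rgt i) then ∑ c : Bool, u (recolour i f c) else 0 := by
  split_ifs with h
  · symm
    refine Fintype.sum_of_injective (recolour i f) (fun a b e => ?_) _ _ ?_ ?_
    · simpa [recolour] using congrFun e (lft i)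
    · intro g hg
      by_contra hne
      have h0 := left_ne_zero_of_mul hne
      simp only [colourMatrix, ne_eq, ite_eq_right_iff, Classical.not_imp] at h0
      obtain ⟨⟨h1, h2, h3⟩, -⟩ := h0
      refine hg ⟨g (lft i), ?_⟩
      funext j
      unfold recolour
      split_ifs with hj
      · rcases hj with rfl | rfl
        · rfl
        · exact h2
      · rw [not_or] at hj
        exact h3 j hj.1 hj.2
    · intro c
      have : ColourRel i f (recolour i f c) :=
        ⟨h, by simp [recolour], fun j h1 h2 => by simp [recolour, h1, h2]⟩
      simp [colourMatrix, this]
  · refine Finset.sum_eq_zero fun g _ => ?_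
    simp [colourMatrix, ColourRel, h]

theorem recolour_of_ne {f : Fin l → Bool} {c : Bool} {j : Fin l} (h1 : j ≠ lft i)
    (h2 : j ≠ rgt i) : recolour i f c j = f j := by simp [recolour, h1, h2]

@[simp] theorem recolour_lft {f : Fin l → Bool} {c : Bool} : recolour i f c (lft i) = c := by
  simp [recolour]

@[simp] theorem recolour_rgt {f : Fin l → Bool} {c : Bool} : recolour i f c (rgt i) = c := by
  simp [recolour]

theorem colourMatrix_mulVec_colourVector (i : Fin (l - 1)) (M : Fin l → Fin l) (hM : IsPlanar M) :
    (colourMatrix i).mulVec (colourVector M) =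
      (if M (lft i) = rgt i then 2 else 1) • colourVector (cupCap i M) := by
  funext f
  rw [colourMatrix_mulVec, Pi.smul_apply, smul_eq_mul]
  by_cases hf : f (lft i) = f (rgt i)
  swap
  · have : ¬ ∀ j, f (cupCap i M j) = f j := fun h => hf (by simpa using h (rgt i))
    simp [hf, colourVector, this]
  rw [if_pos hf]
  by_cases h : M (lft i) = rgt i
  · rw [if_pos h, cupCap_eq_self hM h]
    have h' : M (rgt i) = lft i := by rw [← h, hM.invol]
    have key : ∀ c, colourVector M (recolour i f c) = colourVector M f := by
      intro c
      unfold colourVector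
      congr 1
      rw [eq_iff_iff]
      refine forall_congr' fun j => ?_
      by_cases h1 : j = lft i
      · simp [h1, h, hf]
      by_cases h2 : j = rgt i
      · simp [h2, h', hf]
      rw [recolour_of_ne h1 h2, recolour_of_ne]
      · exact fun e => h2 (by rw [← h, ← e, hM.invol])
      · exact fun e => h1 (by rw [← h', ← e, hM.invol])
    simp [key]
  · rw [if_neg h, one_mul]
    have hA := hM.ne (lft i)
    have hB := hM.ne (rgt i)
    have hB' : M (rgt i) ≠ lft i := fun e => h (by rw [← e, hM.invol])
    have key : ∀ c, colourVector M (recolour i f c) =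
        if c = f (M (lft i)) then colourVector (cupCap i M) f else 0 := by
      intro c
      unfold colourVector
      rw [← ite_and]
      congr 1
      rw [eq_iff_iff]
      constructor
      · intro hc
        have k1 := hc (lft i)
        have k2 := hc (rgt i)
        rw [recolour_lft, recolour_of_ne hA h] at k1
        rw [recolour_rgt, recolour_of_ne hB' hB] at k2
        refine ⟨k1.symm, fun j => ?_⟩
        rcases cupCap_cases hM h j with ⟨p, q⟩ | ⟨p, q⟩ | ⟨p, q⟩ | ⟨p, q⟩ | ⟨p, p', q⟩ <;>
          rw [q]
        · rw [p, hf]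
        · rw [p, hf]
        · rw [p, k1, k2]
        · rw [p, k1, k2]
        · have := hc j
          rwa [recolour_of_ne p.1 p.2.1, recolour_of_ne p'.1 p'.2.1] at this
      · rintro ⟨rfl, hc⟩ j
        have k := hc (M (rgt i))
        rw [cupCap_apply_rgt hM h] at k
        rcases cupCap_cases hM h j with ⟨p, q⟩ | ⟨p, q⟩ | ⟨p, q⟩ | ⟨p, q⟩ | ⟨p, p', q⟩
        · rw [p, recolour_lft, recolour_of_ne hA h]
        · rw [p, recolour_rgt, recolour_of_ne hB' hB, k]
        · rw [p, hM.invol, recolour_lft, recolour_of_ne hA h]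
        · rw [p, hM.invol, recolour_rgt, recolour_of_ne hB' hB, k]
        · rw [recolour_of_ne p.1 p.2.1, recolour_of_ne p'.1 p'.2.1, ← q]
          exact hc j
    simp [key]

end

theorem capMatching_lft {m : ℕ} {i : Fin (2 * m - 1)} (hi : (i : ℕ) % 2 = 0) :
    capMatching m (lft i) = rgt i := by
  simp [capMatching, lft, rgt, hi]

theorem forall_capMatching_iff {m : ℕ} (f : Fin (2 * m) → Bool) :
    (∀ j, f (capMatching m j) = f j) ↔
      ∀ j : Fin m, f ⟨2 * j, by omega⟩ = f ⟨2 * j + 1, by omega⟩ := by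
  constructor
  · intro h j
    rw [← h ⟨2 * j, by omega⟩]
    congr 1
    simp [capMatching]
  · intro h j
    have := h ⟨j / 2, by omega⟩
    unfold capMatching
    split_ifs with hj
    · convert this.symm using 2 <;> simp only [Fin.ext_iff] <;> omega
    · convert this using 2 <;> simp only [Fin.ext_iff] <;> omega

theorem vecMul_colourVector_capMatching {m : ℕ} (i : Fin (2 * m - 1)) (hi : (i : ℕ) % 2 = 0) :
    Matrix.vecMul (colourVector (capMatching m)) (colourMatrix i) =
      2 • colourVector (capMatching m) := by
  have hM := isPlanar_capMatching m
  have h := capMatching_lft hi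
  rw [← Matrix.mulVec_transpose, colourMatrix_transpose, colourMatrix_mulVec_colourVector i _ hM,
    if_pos h, cupCap_eq_self hM h]

theorem colourVector_dotProduct_self (m : ℕ) :
    colourVector (capMatching m) ⬝ᵥ colourVector (capMatching m) = 2 ^ m := by
  have h1 : colourVector (capMatching m) ⬝ᵥ colourVector (capMatching m) =
      Fintype.card {f : Fin (2 * m) → Bool // ∀ j, f (capMatching m j) = f j} := by
    rw [Fintype.card_subtype, Finset.card_filter]
    refine Finset.sum_congr rfl fun f _ => ?_
    simp [colourVector]
  have e : {f : Fin (2 * m) → Bool // ∀ j, f (capMatching m j) = f j} ≃ (Fin m → Bool) :=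
    { toFun := fun f j => f.1 ⟨2 * j, by omega⟩
      invFun := fun g => ⟨fun j => g ⟨j / 2, by omega⟩, by
        refine (forall_capMatching_iff fun j : Fin (2 * m) => g ⟨j / 2, by omega⟩).2 fun j => ?_
        congr 1
        simp only [Fin.ext_iff]
        omega⟩
      left_inv := fun ⟨f, hf⟩ => by
        rw [forall_capMatching_iff] at hf
        refine Subtype.ext (funext fun j => ?_)
        have h := hf ⟨j / 2, by omega⟩
        change f ⟨2 * (j / 2), _⟩ = f j
        rcases Nat.mod_two_eq_zero_or_one j with hj | hj
        · congr 1
          simp only [Fin.ext_iff]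
          omega
        · rw [h]
          congr 1
          simp only [Fin.ext_iff]
          omega
      right_inv := fun g => by
        funext j
        simp }
  rw [h1, Fintype.card_congr e]
  simp

/-- A product of matrices between two vectors as a sum over sequences of indices. -/
theorem dotProduct_prod_mulVec {X R : Type*} [Fintype X] [DecidableEq X] [CommSemiring R] {n : ℕ}
    (T : Fin n → Matrix X X R) (v w : X → R) :
    v ⬝ᵥ ((List.ofFn T).prod).mulVec w =
      ∑ r : Fin (n + 1) → X,
        v (r 0) * (∏ k, T k (r k.castSucc) (r k.succ)) * w (r (Fin.last n)) := by
  induction n generalizing v with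
  | zero =>
    simp only [List.ofFn_zero, List.prod_nil, Matrix.one_mulVec, Finset.univ_eq_empty,
      Finset.prod_empty, mul_one, dotProduct]
    exact (Fintype.sum_equiv (Equiv.funUnique (Fin 1) X) _ _ fun r => rfl).symm
  | succ n ih =>
    rw [List.ofFn_succ, List.prod_cons, ← Matrix.mulVec_mulVec, Matrix.dotProduct_mulVec, ih,
      ← Equiv.sum_comp (Fin.consEquiv fun _ : Fin (n + 2) => X), Fintype.sum_prod_type,
      Finset.sum_comm]
    refine Finset.sum_congr rfl fun r _ => ?_
    simp only [Matrix.vecMul, dotProduct, Finset.sum_mul]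
    refine Finset.sum_congr rfl fun x _ => ?_
    have hlast : Fin.last (n + 1) = (Fin.last n).succ := rfl
    rw [Fin.prod_univ_succ]
    simp only [Fin.consEquiv_apply, Fin.cons_zero, Fin.castSucc_zero, Fin.cons_succ, hlast,
      ← Fin.succ_castSucc]
    ring

/-- The Temperley-Lieb word of the state `s` of the plat closure of `B`: a smoothing of a crossing
is either a pair of vertical strands or the generator. -/
def stateWord {m : ℕ} (B : BraidWord (2 * m)) (s : Fin B.length → Bool) :
    List (Fin (2 * m - 1) × Bool) :=
  List.ofFn fun k : Fin B.length => (B[k].1, s k == B[k].2)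

section
variable {m : ℕ} {B : BraidWord (2 * m)}

theorem cornerPt_eq (k : Fin B.length) (q : Fin 4) :
    (platClosure B).cornerPt k q = (platGlue B (Sum.inr (k, q))).1 := rfl

theorem arcPt_eq (a : PlatArc B) (e : Fin 2) :
    (platClosure B).arcPt a e = (platGlue B (Sum.inl (a, e))).1 := rfl

theorem cornerPt_of_true {k : Fin B.length} (h : B[k].2 = true) :
    (platClosure B).cornerPt k 0 = (k.castSucc, rgt B[k].1) ∧
    (platClosure B).cornerPt k 1 = (k.castSucc, lft B[k].1) ∧
    (platClosure B).cornerPt k 2 = (k.succ, lft B[k].1) ∧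
    (platClosure B).cornerPt k 3 = (k.succ, rgt B[k].1) := by
  simp [cornerPt_eq, platGlue, h, lft, rgt, -Fin.getElem_fin]

theorem cornerPt_of_false {k : Fin B.length} (h : B[k].2 = false) :
    (platClosure B).cornerPt k 0 = (k.castSucc, lft B[k].1) ∧
    (platClosure B).cornerPt k 1 = (k.succ, lft B[k].1) ∧
    (platClosure B).cornerPt k 2 = (k.succ, rgt B[k].1) ∧
    (platClosure B).cornerPt k 3 = (k.castSucc, rgt B[k].1) := by
  simp [cornerPt_eq, platGlue, h, lft, rgt, -Fin.getElem_fin]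

theorem arcPt_cap (j : Fin m) :
    (platClosure B).arcPt (PlatArc.cap j) 0 = (0, ⟨2 * j, by omega⟩) ∧
    (platClosure B).arcPt (PlatArc.cap j) 1 = (0, ⟨2 * j + 1, by omega⟩) := by
  simp [arcPt_eq, platGlue]

theorem arcPt_cup (j : Fin m) :
    (platClosure B).arcPt (PlatArc.cup j) 0 = (Fin.last _, ⟨2 * j, by omega⟩) ∧
    (platClosure B).arcPt (PlatArc.cup j) 1 = (Fin.last _, ⟨2 * j + 1, by omega⟩) := by
  simp [arcPt_eq, platGlue]

theorem arcPt_strand (k : Fin B.length) (j : Fin (2 * m)) (h) :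
    (platClosure B).arcPt (PlatArc.strand k j h) 0 = (k.castSucc, j) ∧
    (platClosure B).arcPt (PlatArc.strand k j h) 1 = (k.succ, j) := by
  simp [arcPt_eq, platGlue]

/-- A colouring of the cut points is constant along the curves of a state if and only if its rows
fit the caps, the layers and the cups. -/
theorem forall_joined_iff (s : Fin B.length → Bool)
    (f : Fin (B.length + 1) → Fin (2 * m) → Bool) :
    (∀ p q : (platClosure B).Point,
      (platClosure B).Joined s p q → f p.1 p.2 = f q.1 q.2) ↔
    (∀ j, f 0 (capMatching m j) = f 0 j) ∧
    (∀ k : Fin B.length, if (s k == B[k].2) = true then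
      ColourRel B[k].1 (f k.castSucc) (f k.succ) else f k.castSucc = f k.succ) ∧
    (∀ j, f (Fin.last _) (capMatching m j) = f (Fin.last _) j) := by
  constructor
  · intro h
    refine ⟨?_, fun k => ?_, ?_⟩
    · rw [forall_capMatching_iff]
      intro j
      have := h _ _ (.arc (PlatArc.cap j))
      rwa [(arcPt_cap j).1, (arcPt_cap j).2] at this
    · have hst : ∀ j, j ≠ lft B[k].1 → j ≠ rgt B[k].1 → f k.castSucc j = f k.succ j := by
        intro j h1 h2
        have hj : (j : ℕ) ≠ B[k].1 ∧ (j : ℕ) ≠ B[k].1 + 1 :=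
          ⟨fun e => h1 (Fin.ext e), fun e => h2 (Fin.ext e)⟩
        have := h _ _ (.arc (PlatArc.strand k j hj))
        rwa [(arcPt_strand k j hj).1, (arcPt_strand k j hj).2] at this
      have hid : f k.castSucc (lft B[k].1) = f k.succ (lft B[k].1) →
          f k.castSucc (rgt B[k].1) = f k.succ (rgt B[k].1) → f k.castSucc = f k.succ := by
        intro h1 h2
        funext j
        by_cases hj1 : j = lft B[k].1
        · rw [hj1, h1]
        by_cases hj2 : j = rgt B[k].1
        · rw [hj2, h2]
        exact hst j hj1 hj2
      cases hb : B[k].2 <;> cases hs : s k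
      · obtain ⟨c0, c1, c2, c3⟩ := cornerPt_of_false hb
        have h1 := h _ _ (.b₁ k hs)
        have h2 := h _ _ (.b₂ k hs)
        rw [c1, c2] at h1
        rw [c3, c0] at h2
        exact ⟨h2.symm, h1, hst⟩
      · obtain ⟨c0, c1, c2, c3⟩ := cornerPt_of_false hb
        have h1 := h _ _ (.a₁ k hs)
        have h2 := h _ _ (.a₂ k hs)
        rw [c0, c1] at h1
        rw [c2, c3] at h2
        exact hid h1 h2.symm
      · obtain ⟨c0, c1, c2, c3⟩ := cornerPt_of_true hb
        have h1 := h _ _ (.b₁ k hs)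
        have h2 := h _ _ (.b₂ k hs)
        rw [c1, c2] at h1
        rw [c3, c0] at h2
        exact hid h1 h2.symm
      · obtain ⟨c0, c1, c2, c3⟩ := cornerPt_of_true hb
        have h1 := h _ _ (.a₁ k hs)
        have h2 := h _ _ (.a₂ k hs)
        rw [c0, c1] at h1
        rw [c2, c3] at h2
        exact ⟨h1.symm, h2, hst⟩
    · rw [forall_capMatching_iff]
      intro j
      have := h _ _ (.arc (PlatArc.cup j))
      rwa [(arcPt_cup j).1, (arcPt_cup j).2] at this
  · rintro ⟨h0, hk, hl⟩ p q hpq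
    rw [forall_capMatching_iff] at h0 hl
    cases hpq with
    | arc a =>
      rcases a with ⟨k, j, hj⟩ | j | j
      · rw [(arcPt_strand k j hj).1, (arcPt_strand k j hj).2]
        have := hk k
        split_ifs at this
        · exact this.2.2 j (fun e => hj.1 (congrArg Fin.val e)) fun e => hj.2 (congrArg Fin.val e)
        · exact congrFun this j
      · rw [(arcPt_cap j).1, (arcPt_cap j).2]
        exact h0 j
      · rw [(arcPt_cup j).1, (arcPt_cup j).2]
        exact hl j
    | a₁ k hs =>
      have := hk k
      cases hb : B[k].2
      · obtain ⟨c0, c1, c2, c3⟩ := cornerPt_of_false hb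
        rw [hs, hb] at this
        rw [c0, c1]
        exact congrFun this _
      · obtain ⟨c0, c1, c2, c3⟩ := cornerPt_of_true hb
        rw [hs, hb] at this
        rw [c0, c1]
        exact this.1.symm
    | a₂ k hs =>
      have := hk k
      cases hb : B[k].2
      · obtain ⟨c0, c1, c2, c3⟩ := cornerPt_of_false hb
        rw [hs, hb] at this
        rw [c2, c3]
        exact (congrFun this _).symm
      · obtain ⟨c0, c1, c2, c3⟩ := cornerPt_of_true hb
        rw [hs, hb] at this
        rw [c2, c3]
        exact this.2.1
    | b₁ k hs =>
      have := hk k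
      cases hb : B[k].2
      · obtain ⟨c0, c1, c2, c3⟩ := cornerPt_of_false hb
        rw [hs, hb] at this
        rw [c1, c2]
        exact this.2.1
      · obtain ⟨c0, c1, c2, c3⟩ := cornerPt_of_true hb
        rw [hs, hb] at this
        rw [c1, c2]
        exact congrFun this _
    | b₂ k hs =>
      have := hk k
      cases hb : B[k].2
      · obtain ⟨c0, c1, c2, c3⟩ := cornerPt_of_false hb
        rw [hs, hb] at this
        rw [c3, c0]
        exact this.1.symm
      · obtain ⟨c0, c1, c2, c3⟩ := cornerPt_of_true hb
        rw [hs, hb] at this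
        rw [c3, c0]
        exact (congrFun this _).symm

/-- A state with `c` closed curves has `2 ^ c` two-colourings, which are counted by the transfer
matrices of the layers. -/
theorem two_pow_loops (s : Fin B.length → Bool) :
    2 ^ (platClosure B).loops s =
      colourVector (capMatching m) ⬝ᵥ
        (wordMatrix colourMatrix (stateWord B s)).mulVec (colourVector (capMatching m)) := by
  classical
  have : Finite (Quot ((platClosure B).Joined s)) :=
    inferInstanceAs (Finite (Quot (α := Fin (B.length + 1) × Fin (2 * m)) _))
  have e : (Quot ((platClosure B).Joined s) → Bool) ≃
      {f : Fin (B.length + 1) → Fin (2 * m) → Bool //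
        (∀ j, f 0 (capMatching m j) = f 0 j) ∧
        (∀ k : Fin B.length, if (s k == B[k].2) = true then
          ColourRel B[k].1 (f k.castSucc) (f k.succ) else f k.castSucc = f k.succ) ∧
        (∀ j, f (Fin.last _) (capMatching m j) = f (Fin.last _) j)} :=
    { toFun := fun g => ⟨fun k j => g (Quot.mk _ (k, j)), by
        refine (forall_joined_iff s fun k j => g (Quot.mk _ (k, j))).1 fun p q h => ?_
        exact congrArg g (Quot.sound h)⟩
      invFun := fun f => Quot.lift (fun p => f.1 p.1 p.2) ((forall_joined_iff s f.1).2 f.2)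
      left_inv := fun g => by
        funext x
        induction x using Quot.ind
        rfl
      right_inv := fun f => rfl }
  have h1 := Nat.card_congr e
  rw [Nat.card_fun, Nat.card_eq_fintype_card (α := Bool), Fintype.card_bool,
    Nat.card_eq_fintype_card (α := Subtype _), Fintype.card_subtype, Finset.card_filter] at h1
  rw [LinkDiagram.loops, h1, wordMatrix, stateWord, List.map_ofFn, dotProduct_prod_mulVec]
  refine Finset.sum_congr rfl fun r _ => ?_
  have h2 : ∏ k : Fin B.length,
      ((fun g : Fin (2 * m - 1) × Bool => if g.2 = true then colourMatrix g.1 else 1) ∘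
        fun k : Fin B.length => (B[k].1, s k == B[k].2)) k (r k.castSucc) (r k.succ) =
      if ∀ k : Fin B.length, if (s k == B[k].2) = true then
        ColourRel B[k].1 (r k.castSucc) (r k.succ) else r k.castSucc = r k.succ then 1 else 0 := by
    trans ∏ k : Fin B.length, if (if (s k == B[k].2) = true then
        ColourRel B[k].1 (r k.castSucc) (r k.succ) else r k.castSucc = r k.succ) then 1 else 0
    swap
    · rw [Finset.prod_boole]
      simp only [Finset.mem_univ, true_imp_iff]
    refine Finset.prod_congr rfl fun k _ => ?_
    simp only [Function.comp_apply]
    cases s k == B[k].2 <;> simp [colourMatrix, Matrix.one_apply]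
  rw [h2]
  simp only [colourVector]
  split_ifs <;> simp_all

end

/-! ### The gate of a braid generator as a Kauffman bracket -/

/-- The value `e^{-3πi/5}` of the bracket variable. -/
def bracketVar : ℂ := Complex.exp (-(3 * Real.pi / 5) * Complex.I)

theorem bracketVar_ne_zero : bracketVar ≠ 0 := Complex.exp_ne_zero _

/-- The root of unity `e^{πi/5}`. -/
def tenthRoot : ℂ := Complex.exp (Real.pi / 5 * Complex.I)

theorem tenthRoot_pow_five : tenthRoot ^ 5 = -1 := by
  rw [tenthRoot, ← Complex.exp_nat_mul, ← Complex.exp_pi_mul_I]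
  congr 1
  push_cast
  ring

theorem tenthRoot_inv : tenthRoot⁻¹ = -tenthRoot ^ 4 := by
  refine inv_eq_of_mul_eq_one_right ?_
  linear_combination -tenthRoot_pow_five

theorem goldenRatio_eq : (Real.goldenRatio : ℂ) = tenthRoot - tenthRoot ^ 4 := by
  have h : (Real.goldenRatio : ℝ) = 2 * Real.cos (Real.pi / 5) := by
    rw [Real.cos_pi_div_five, Real.goldenRatio]
    ring
  rw [h]
  push_cast
  rw [sub_eq_add_neg, ← tenthRoot_inv, tenthRoot, Complex.cos, ← Complex.exp_neg]
  ring_nf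

theorem tenthRoot_cyclotomic :
    tenthRoot ^ 4 - tenthRoot ^ 3 + tenthRoot ^ 2 - tenthRoot + 1 = 0 := by
  have h : (Real.goldenRatio : ℂ) ^ 2 = Real.goldenRatio + 1 := by
    exact_mod_cast Real.goldenRatio_sq
  rw [goldenRatio_eq] at h
  linear_combination h + (2 - tenthRoot ^ 3) * tenthRoot_pow_five

theorem bracketVar_eq : bracketVar = -tenthRoot ^ 2 := by
  have h : bracketVar = tenthRoot⁻¹ ^ 3 := by
    rw [bracketVar, tenthRoot, ← Complex.exp_neg, ← Complex.exp_nat_mul]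
    congr 1
    push_cast
    ring
  rw [h, tenthRoot_inv]
  linear_combination -(tenthRoot ^ 7 - tenthRoot ^ 2) * tenthRoot_pow_five

theorem bracketVar_inv : bracketVar⁻¹ = tenthRoot ^ 3 := by
  rw [bracketVar_eq]
  refine inv_eq_of_mul_eq_one_right ?_
  linear_combination -tenthRoot_pow_five

theorem exp_four : Complex.exp (4 * Real.pi / 5 * Complex.I) = tenthRoot ^ 4 := by
  rw [tenthRoot, ← Complex.exp_nat_mul]
  congr 1
  push_cast
  ring

theorem exp_neg_four : Complex.exp (-(4 * Real.pi / 5) * Complex.I) = -tenthRoot := by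
  have : Complex.exp (-(4 * Real.pi / 5) * Complex.I) = tenthRoot⁻¹ ^ 4 := by
    rw [tenthRoot, ← Complex.exp_neg, ← Complex.exp_nat_mul]
    congr 1
    push_cast
    ring
  rw [this, tenthRoot_inv]
  linear_combination (tenthRoot ^ 11 - tenthRoot ^ 6 + tenthRoot) * tenthRoot_pow_five

theorem exp_three : Complex.exp (3 * Real.pi / 5 * Complex.I) = bracketVar⁻¹ := by
  rw [bracketVar, ← Complex.exp_neg]
  congr 1
  ring

/-- The value of a closed curve. -/
theorem neg_bracketVar_sq_sub : -bracketVar ^ 2 - bracketVar⁻¹ ^ 2 = Real.goldenRatio := by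
  rw [bracketVar_inv, bracketVar_eq, goldenRatio_eq]
  linear_combination -tenthRoot * tenthRoot_pow_five

theorem goldenRatio_complex_ne_zero : (Real.goldenRatio : ℂ) ≠ 0 :=
  Complex.ofReal_ne_zero.2 Real.goldenRatio_ne_zero

theorem goldenRatio_inv_mul : (Real.goldenRatio : ℂ)⁻¹ * tenthRoot ^ 4 =
    bracketVar⁻¹ + bracketVar * (1 / (Real.goldenRatio : ℂ)) := by
  have h := goldenRatio_complex_ne_zero
  rw [bracketVar_inv, bracketVar_eq]
  field_simp
  rw [goldenRatio_eq]
  linear_combination tenthRoot ^ 2 * tenthRoot_pow_five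

theorem goldenRatio_rpow_neg_half :
    ((Real.goldenRatio ^ (-(1 / 2) : ℝ) : ℝ) : ℂ) = (dimRoot true ^ 2)⁻¹ := by
  simp only [dimRoot, if_true]
  norm_cast
  rw [← Real.rpow_natCast, ← Real.rpow_mul Real.goldenRatio_pos.le, ← Real.rpow_neg
    Real.goldenRatio_pos.le]
  norm_num

theorem fibEntry_eq : ∀ x y : Bits3, IsFib3 x → IsFib3 y → fibEntry x y =
    bracketVar⁻¹ * (if x = y then 1 else 0) + bracketVar * generatorEntry x y := by
  have hf : dimRoot false = 1 := rfl
  have hq := dimRoot_ne_zero true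
  have hexp : Complex.exp (-(3 * Real.pi / 5) * Complex.I) = bracketVar := rfl
  have h4 : dimRoot true ^ 2 * dimRoot true ^ 2 = Real.goldenRatio := by
    rw [← dimRoot_true_pow_four]
    ring
  have h5 : (dimRoot true ^ 2)⁻¹ * bracketVar =
      bracketVar * (dimRoot true ^ 2 / Real.goldenRatio) := by
    rw [← h4]
    field_simp
  have h010 : -tenthRoot = bracketVar⁻¹ + bracketVar * Real.goldenRatio := by
    rw [bracketVar_inv, bracketVar_eq, goldenRatio_eq]
    linear_combination -tenthRoot * tenthRoot_pow_five
  have h111 : -(Real.goldenRatio : ℂ)⁻¹ = bracketVar⁻¹ + bracketVar := by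
    have h := goldenRatio_complex_ne_zero
    rw [bracketVar_inv, bracketVar_eq, neg_eq_iff_eq_neg]
    refine inv_eq_of_mul_eq_one_right ?_
    rw [goldenRatio_eq]
    linear_combination (tenthRoot ^ 2 - tenthRoot) * tenthRoot_pow_five - tenthRoot_cyclotomic
  rintro ⟨a, b, c⟩ ⟨a', b', c'⟩ hx hy
  cases a <;> cases b <;> cases c <;> cases a' <;> cases b' <;> cases c' <;>
    first
    | exact absurd hx (by decide)
    | exact absurd hy (by decide)
    | simp only [fibEntry, generatorEntry, IsFib3, exp_four, exp_neg_four, exp_three, hexp, hf, h4,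
        goldenRatio_rpow_neg_half, h5, goldenRatio_inv_mul, dimRoot_true_pow_four, h010, h111,
        Prod.mk.injEq, Bool.or_true, Bool.or_false, and_true,
        and_false, and_self, if_true, if_false, reduceCtorEq, one_pow, mul_one, one_mul, mul_zero,
        add_zero, zero_add, div_one, div_self goldenRatio_complex_ne_zero]

/-- The entries of the inverse gate, which are the complex conjugates. -/
theorem star_fibEntry_eq (x y : Bits3) (hx : IsFib3 x) (hy : IsFib3 y) : star (fibEntry y x) =
    bracketVar * (if x = y then 1 else 0) + bracketVar⁻¹ * generatorEntry x y := by
  have h1 : star bracketVar = bracketVar⁻¹ := by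
    rw [← exp_three, bracketVar, Complex.star_def, ← Complex.exp_conj]
    congr 1
    simp [Complex.conj_ofReal, Complex.conj_ofNat]
  have h2 : ∀ b, star (dimRoot b) = dimRoot b := by
    intro b
    cases b
    · simp [dimRoot]
    · simp only [dimRoot, if_true, Complex.star_def, Complex.conj_ofReal]
  have h3 : star (generatorEntry y x) = generatorEntry x y := by
    unfold generatorEntry
    rw [apply_ite star]
    simp only [star_div₀, star_mul', star_pow, h2, star_zero]
    by_cases h : IsFib3 x ∧ IsFib3 y ∧ x.1 = x.2.2 ∧ y.1 = x.1 ∧ y.2.2 = x.2.2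
    · have h' : IsFib3 y ∧ IsFib3 x ∧ y.1 = y.2.2 ∧ x.1 = y.1 ∧ x.2.2 = y.2.2 := by grind
      rw [if_pos h, if_pos h', h.2.2.2.1, mul_comm]
    · have h' : ¬ (IsFib3 y ∧ IsFib3 x ∧ y.1 = y.2.2 ∧ x.1 = y.1 ∧ x.2.2 = y.2.2) := by grind
      rw [if_neg h, if_neg h']
  rw [fibEntry_eq y x hy hx, star_add, star_mul', star_mul', h3, star_inv₀, h1, inv_inv,
    apply_ite star, star_one, star_zero]
  simp only [eq_comm]

section
variable {l : ℕ} {i : Fin (l - 1)}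

/-- Bit strings without two consecutive zeros. -/
def IsFib (s : Fin (l + 1) → Bool) : Prop := ∀ j : Fin l, (s j.castSucc || s j.succ) = true

/-- Vectors in the span of the bit strings without two consecutive zeros. -/
def IsFibVector (v : (Fin (l + 1) → Bool) → ℂ) : Prop := ∀ s, v s ≠ 0 → IsFib s

theorem IsFibVector.generator {v : (Fin (l + 1) → Bool) → ℂ} (hv : IsFibVector v) :
    IsFibVector ((applyGate generatorEntry i).mulVec v) := by
  intro s hs j
  rw [applyGate_generatorEntry_mulVec] at hs
  obtain ⟨y, -, hy⟩ := Finset.exists_ne_zero_of_sum_ne_zero hs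
  have h1 := left_ne_zero_of_mul hy
  have h2 := hv _ (right_ne_zero_of_mul hy) j
  simp only [generatorEntry, ne_eq, ite_eq_right_iff, Classical.not_imp] at h1
  obtain ⟨⟨⟨k1, k2⟩, -⟩, -⟩ := h1
  by_cases hj1 : j = lft i
  · rw [hj1]; exact k1
  by_cases hj2 : j = rgt i
  · rw [hj2, castSucc_rgt_eq]; exact k2
  rwa [update_mid_castSucc hj2, update_mid_succ hj1] at h2

/-- A three-qubit gate that is a combination of the identity and the generator on the strings
without two consecutive zeros acts so on every vector in the span of such strings. -/
theorem applyGate_mulVec_of_eq {G : Matrix Bits3 Bits3 ℂ} {c d : ℂ}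
    (hG : ∀ x y, IsFib3 y → G x y = c * (if x = y then 1 else 0) + d * generatorEntry x y)
    {v : (Fin (l + 1) → Bool) → ℂ} (hv : IsFibVector v) :
    (applyGate G i).mulVec v = c • v + d • (applyGate generatorEntry i).mulVec v := by
  funext s
  have key : ∀ t, applyGate G i s t * v t =
      c * ((if s = t then 1 else 0) * v t) + d * (applyGate generatorEntry i s t * v t) := by
    intro t
    by_cases ht : v t = 0
    · simp [ht]
    have hfib := hv t ht
    rw [← mul_assoc, ← mul_assoc, ← add_mul]
    congr 1
    unfold applyGate
    split_ifs with h1 h2 h2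
    · rw [hG _ _ ⟨hfib (lft i), hfib (rgt i)⟩, h2, if_pos rfl]
    · rw [hG _ _ ⟨hfib (lft i), hfib (rgt i)⟩, if_neg]
      intro h3
      simp only [Prod.mk.injEq] at h3
      refine h2 (funext fun j => ?_)
      by_cases hj : (j : ℕ) < i ∨ (i : ℕ) + 2 < j
      · exact h1 j hj
      · have hj' : j = ⟨i, by omega⟩ ∨ j = ⟨i + 1, by omega⟩ ∨ j = ⟨i + 2, by omega⟩ := by
          simp only [Fin.ext_iff]
          omega
        rcases hj' with e | e | e <;> rw [e]
        · exact h3.1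
        · exact h3.2.1
        · exact h3.2.2
    · exact absurd (fun j _ => by rw [h2]) h1
    · simp
  simp only [Matrix.mulVec, dotProduct, key, Finset.sum_add_distrib, ← Finset.mul_sum,
    Pi.add_apply, Pi.smul_apply, smul_eq_mul]
  congr 2
  simp

/-- The coefficient of a smoothing in the bracket. -/
def smoothingWeight (b : Bool) : ℂ := if b = true then bracketVar else bracketVar⁻¹

/-- The operator of a layer with the crossing `g` smoothed in the way `b`. -/
def layerMatrix (g : Fin (l - 1) × Bool) (b : Bool) :
    Matrix (Fin (l + 1) → Bool) (Fin (l + 1) → Bool) ℂ :=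
  if (b == g.2) = true then applyGate generatorEntry g.1 else 1

theorem IsFibVector.layer {v : (Fin (l + 1) → Bool) → ℂ} (hv : IsFibVector v)
    (g : Fin (l - 1) × Bool) (b : Bool) : IsFibVector ((layerMatrix g b).mulVec v) := by
  unfold layerMatrix
  split_ifs
  · exact hv.generator
  · rwa [Matrix.one_mulVec]

theorem applyGate_fibGate_mulVec (W : Matrix {x : Bits3 // ¬ IsFib3 x} {x : Bits3 // ¬ IsFib3 x} ℂ)
    (g : Fin (l - 1) × Bool) {v : (Fin (l + 1) → Bool) → ℂ} (hv : IsFibVector v) :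
    (applyGate (if g.2 = true then fibGate W else (fibGate W).conjTranspose) g.1).mulVec v =
      (∑ b, smoothingWeight b • layerMatrix g b).mulVec v := by
  have hgen : ∀ x y, ¬ IsFib3 x → generatorEntry x y = 0 := fun x y hx => by
    simp [generatorEntry, hx]
  have hne : ∀ x y, ¬ IsFib3 x → IsFib3 y → x ≠ y := fun x y hx hy e => hx (e ▸ hy)
  obtain ⟨i, _ | _⟩ := g
  · have hG : ∀ x y, IsFib3 y → (fibGate W).conjTranspose x y =
        bracketVar * (if x = y then 1 else 0) + bracketVar⁻¹ * generatorEntry x y := by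
      intro x y hy
      by_cases hx : IsFib3 x
      · rw [Matrix.conjTranspose_apply, fibGate, dif_pos hy, if_pos hx, star_fibEntry_eq x y hx hy]
      · rw [Matrix.conjTranspose_apply, fibGate, dif_pos hy, if_neg hx, if_neg (hne _ _ hx hy),
          hgen x y hx]
        simp
    simp only [Bool.false_eq_true, if_false]
    rw [applyGate_mulVec_of_eq hG hv]
    simp [layerMatrix, smoothingWeight, Matrix.add_mulVec, Matrix.smul_mulVec]
  · have hG : ∀ x y, IsFib3 y → fibGate W x y =
        bracketVar⁻¹ * (if x = y then 1 else 0) + bracketVar * generatorEntry x y := by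
      intro x y hy
      by_cases hx : IsFib3 x
      · rw [fibGate, dif_pos hx, if_pos hy, fibEntry_eq x y hx hy]
      · rw [fibGate, dif_neg hx, dif_pos hy, if_neg (hne _ _ hx hy), hgen x y hx]
        simp
    simp only [if_true]
    rw [applyGate_mulVec_of_eq hG hv]
    simp [layerMatrix, smoothingWeight, Matrix.add_mulVec, Matrix.smul_mulVec, add_comm]

/-- The arbitrary part `W` of the gate has no influence: no layer leads out of the span of the
strings without two consecutive zeros. -/
theorem braidOperator_mulVec (W : Matrix {x : Bits3 // ¬ IsFib3 x} {x : Bits3 // ¬ IsFib3 x} ℂ)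
    (B : BraidWord l) {v : (Fin (l + 1) → Bool) → ℂ} (hv : IsFibVector v) :
    (braidOperator W B).mulVec v =
      ((B.map fun g => ∑ b, smoothingWeight b • layerMatrix g b).prod).mulVec v := by
  suffices h : (braidOperator W B).mulVec v =
      ((B.map fun g => ∑ b, smoothingWeight b • layerMatrix g b).prod).mulVec v ∧
      IsFibVector ((braidOperator W B).mulVec v) from h.1
  induction B with
  | nil => simpa [braidOperator] using hv
  | cons g B ih =>
    have h1 : (braidOperator W (g :: B)).mulVec v =
        (∑ b, smoothingWeight b • layerMatrix g b).mulVec ((braidOperator W B).mulVec v) := by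
      rw [← applyGate_fibGate_mulVec W g ih.2, Matrix.mulVec_mulVec]
      simp [braidOperator]
    refine ⟨?_, ?_⟩
    · rw [h1, ih.1, List.map_cons, List.prod_cons, Matrix.mulVec_mulVec]
    · rw [h1]
      intro s hs
      simp only [Matrix.sum_mulVec, Matrix.smul_mulVec, Finset.sum_apply, Pi.smul_apply,
        smul_eq_mul] at hs
      obtain ⟨b, -, hb⟩ := Finset.exists_ne_zero_of_sum_ne_zero hs
      exact ih.2.layer g b s (right_ne_zero_of_mul hb)

end

/-- A product of sums, expanded. -/
theorem prod_ofFn_sum {ι R A : Type*} [Fintype ι] [CommSemiring R] [Semiring A] [Algebra R A]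
    {n : ℕ} (c : ι → R) (T : Fin n → ι → A) :
    (List.ofFn fun k => ∑ b, c b • T k b).prod =
      ∑ s : Fin n → ι, (∏ k, c (s k)) • (List.ofFn fun k => T k (s k)).prod := by
  induction n with
  | zero => simp
  | succ n ih =>
    rw [List.ofFn_succ, List.prod_cons, ih,
      ← Equiv.sum_comp (Fin.consEquiv fun _ : Fin (n + 1) => ι), Fintype.sum_prod_type,
      Finset.sum_mul]
    refine Finset.sum_congr rfl fun b _ => ?_
    rw [Finset.mul_sum]
    refine Finset.sum_congr rfl fun s _ => ?_
    simp [Fin.prod_univ_succ, List.ofFn_succ, smul_smul, mul_comm]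

/-! ### The basis state of the caps -/

section
variable {m : ℕ}

theorem isLabelling_capMatching_iff (s : Fin (2 * m + 1) → Bool) :
    IsLabelling (capMatching m) s ↔ s = alphaString (2 * m) := by
  constructor
  · rintro ⟨h0, h1, h2⟩
    have heven : ∀ p (hp : p ≤ m), s ⟨2 * p, by omega⟩ = false := by
      intro p
      induction p with
      | zero => exact fun _ => h0
      | succ p ih =>
        intro hp
        have := h2 ⟨2 * p, by omega⟩
        rw [← ih (by omega)]
        refine Eq.trans ?_ this.symm
        congr 1
        simp only [capMatching, Fin.ext_iff, Fin.val_succ]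
        simp [mul_add]
    funext j
    rcases Nat.mod_two_eq_zero_or_one j with hj | hj
    · have := heven (j / 2) (by omega)
      simp only [alphaString, hj, zero_ne_one, decide_false]
      rw [← this]
      congr 1
      simp only [Fin.ext_iff]
      omega
    · have h3 := heven (j / 2) (by omega)
      have h4 := h1 ⟨2 * (j / 2), by omega⟩
      simp only [Fin.castSucc_mk, Fin.succ_mk] at h4
      rw [h3, Bool.false_or] at h4
      simp only [alphaString, hj, decide_true]
      rw [← h4]
      congr 1
      simp only [Fin.ext_iff]
      omega
  · rintro rfl
    refine ⟨by simp [alphaString], fun j => ?_, fun j => ?_⟩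
    · simp only [alphaString, Fin.val_castSucc, Fin.val_succ, Bool.or_eq_true, decide_eq_true_eq]
      omega
    · simp only [alphaString, Fin.val_castSucc, Fin.val_succ, capMatching]
      split_ifs <;> simp only [decide_eq_decide] <;> omega

theorem matchingVector_capMatching_apply_ne_zero :
    matchingVector (capMatching m) (alphaString (2 * m)) ≠ 0 := by
  rw [matchingVector, if_pos ((isLabelling_capMatching_iff _).2 rfl)]
  refine Finset.prod_ne_zero_iff.2 fun j _ => ?_
  unfold endWeight
  split_ifs <;> exact div_ne_zero (dimRoot_ne_zero _) (dimRoot_ne_zero _)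

theorem matchingVector_capMatching : matchingVector (capMatching m) =
    matchingVector (capMatching m) (alphaString (2 * m)) • Pi.single (alphaString (2 * m)) 1 := by
  funext s
  by_cases h : s = alphaString (2 * m)
  · simp [h]
  · rw [matchingVector, if_neg fun e => h ((isLabelling_capMatching_iff s).1 e)]
    simp [h]

theorem vecMul_single_alphaString (i : Fin (2 * m - 1)) (hi : (i : ℕ) % 2 = 0) :
    Matrix.vecMul (Pi.single (alphaString (2 * m)) 1) (applyGate generatorEntry i) =
      (Real.goldenRatio : ℂ) • Pi.single (alphaString (2 * m)) 1 := by
  funext t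
  have ha : ∀ (j : ℕ) (hj : j < 2 * m + 1), alphaString (2 * m) ⟨j, hj⟩ = decide (j % 2 = 1) :=
    fun j hj => rfl
  have h0 : (i : ℕ) % 2 ≠ 1 := by omega
  have h1 : ((i : ℕ) + 1) % 2 = 1 := by omega
  have h2 : ((i : ℕ) + 2) % 2 ≠ 1 := by omega
  rw [Matrix.single_one_vecMul, Matrix.row_apply, Pi.smul_apply, smul_eq_mul]
  by_cases h : t = alphaString (2 * m)
  · subst h
    simp only [applyGate, imp_true_iff, if_true, ha, h0, h1, h2, decide_false, decide_true,
      Pi.single_eq_same, mul_one]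
    rw [← dimRoot_true_pow_four]
    simp [generatorEntry, IsFib3, dimRoot_false]
    ring
  · rw [Pi.single_eq_of_ne h, mul_zero]
    unfold applyGate
    split_ifs with hout
    swap
    · rfl
    simp only [ha, h0, h1, h2, decide_false, decide_true, generatorEntry]
    refine if_neg ?_
    simp only [IsFib3]
    rintro ⟨-, ⟨k1, k2⟩, -, k3, k4⟩
    refine h (funext fun j => ?_)
    by_cases hj : (j : ℕ) < i ∨ (i : ℕ) + 2 < j
    · exact (hout j hj).symm
    · have hj' : j = ⟨i, by omega⟩ ∨ j = ⟨i + 1, by omega⟩ ∨ j = ⟨i + 2, by omega⟩ := by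
        simp only [Fin.ext_iff]
        omega
      rw [k3, Bool.false_or] at k1
      rcases hj' with e | e | e <;> rw [e, ha]
      · rw [k3]; simp [h0]
      · rw [k1]; simp [h1]
      · rw [k4]; simp [hi]

/-- The matrix element of a Temperley-Lieb word in the state of the caps counts the closed curves
of the plat closure. -/
theorem goldenRatio_pow_mul_wordMatrix (B : BraidWord (2 * m)) (s : Fin B.length → Bool) :
    (Real.goldenRatio : ℂ) ^ m * wordMatrix (fun i => applyGate generatorEntry i) (stateWord B s)
        (alphaString (2 * m)) (alphaString (2 * m)) =
      (Real.goldenRatio : ℂ) ^ (platClosure B).loops s := by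
  have h1 := pow_mul_dotProduct_wordMatrix colourMatrix_mulVec_colourVector
    vecMul_colourVector_capMatching (stateWord B s)
  rw [← two_pow_loops, colourVector_dotProduct_self, mul_comm] at h1
  -- The number of closed curves is the exponent that occurs in every representation.
  have h2 := Nat.pow_right_injective le_rfl (mul_right_cancel₀ (by positivity) h1)
  have h3 := pow_mul_dotProduct_wordMatrix (v := matchingVector)
    (generator_mulVec_matchingVector (l := 2 * m)) vecMul_single_alphaString (stateWord B s)
  rw [← h2, single_one_dotProduct, single_one_dotProduct, matchingVector_capMatching,
    Matrix.mulVec_smul, Matrix.mulVec_single_one] at h3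
  simp only [Pi.smul_apply, smul_eq_mul, Matrix.col_apply, Pi.single_eq_same, mul_one] at h3
  refine mul_right_cancel₀ matchingVector_capMatching_apply_ne_zero (Eq.trans ?_ h3)
  ring

theorem loops_pos (hm : 0 < m) (B : BraidWord (2 * m)) (s : Fin B.length → Bool) :
    0 < (platClosure B).loops s := by
  have : Finite (Quot ((platClosure B).Joined s)) :=
    inferInstanceAs (Finite (Quot (α := Fin (B.length + 1) × Fin (2 * m)) _))
  have : Nonempty (Quot ((platClosure B).Joined s)) := ⟨Quot.mk _ (0, ⟨0, by omega⟩)⟩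
  exact Nat.card_pos

theorem zpow_smoothingIndex (B : BraidWord (2 * m)) (s : Fin B.length → Bool) :
    ∏ k, smoothingWeight (s k) = bracketVar ^ (platClosure B).smoothingIndex s := by
  have : ∀ S : Finset (Fin B.length), ∏ k ∈ S, smoothingWeight (s k) =
      bracketVar ^ ∑ k ∈ S, (if s k = true then (1 : ℤ) else -1) := by
    intro S
    induction S using Finset.induction_on with
    | empty => simp
    | insert a S ha ih =>
      rw [Finset.prod_insert ha, Finset.sum_insert ha, zpow_add₀ bracketVar_ne_zero, ih,
        smoothingWeight]
      split_ifs <;> simp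
  exact this Finset.univ

/-- The matrix element of the braid operator as a sum over states. -/
theorem braidOperator_alphaString
    (W : Matrix {x : Bits3 // ¬ IsFib3 x} {x : Bits3 // ¬ IsFib3 x} ℂ) (B : BraidWord (2 * m)) :
    braidOperator W B (alphaString (2 * m)) (alphaString (2 * m)) =
      ∑ s : Fin B.length → Bool, bracketVar ^ (platClosure B).smoothingIndex s *
        wordMatrix (fun i => applyGate generatorEntry i) (stateWord B s)
          (alphaString (2 * m)) (alphaString (2 * m)) := by
  have hv : IsFibVector (Pi.single (alphaString (2 * m)) (1 : ℂ)) := by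
    intro s hs
    by_cases h : s = alphaString (2 * m)
    · exact ((isLabelling_capMatching_iff s).2 h).2.1
    · exact absurd (Pi.single_eq_of_ne h _) hs
  have h := congrFun (braidOperator_mulVec W B hv) (alphaString (2 * m))
  rw [Matrix.mulVec_single_one, Matrix.mulVec_single_one, Matrix.col_apply, Matrix.col_apply,
    ← List.ofFn_getElem_eq_map, prod_ofFn_sum, Matrix.sum_apply] at h
  rw [h]
  refine Finset.sum_congr rfl fun s _ => ?_
  rw [Matrix.smul_apply, smul_eq_mul, zpow_smoothingIndex, wordMatrix, stateWord, List.map_ofFn]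
  rfl

end

/-! ### The value of the Jones polynomial -/

/-- The value of the bracket variable, as a unit. -/
def bracketUnit : ℂˣ := Units.mk0 bracketVar bracketVar_ne_zero

theorem sqrtFifthRoot_eq : sqrtFifthRoot = bracketUnit ^ (-2 : ℤ) := by
  ext
  rw [Units.val_zpow_eq_zpow_val, sqrtFifthRoot, bracketUnit, Units.val_mk0, Units.val_mk0,
    bracketVar, ← Complex.exp_int_mul]
  congr 1
  push_cast
  ring

/-- Evaluation after the substitution of `A ^ (-2)` for `t ^ (1 / 2)`. -/
theorem eval₂_mapDomain (a : ℂˣ) (g : ℤ[T;T⁻¹]) :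
    LaurentPolynomial.eval₂ (Int.castRingHom ℂ) a
        (AddMonoidAlgebra.mapDomain (fun k : ℤ => -2 * k) g) =
      LaurentPolynomial.eval₂ (Int.castRingHom ℂ) (a ^ (-2 : ℤ)) g := by
  let F : ℤ[T;T⁻¹] →+* ℤ[T;T⁻¹] :=
    AddMonoidAlgebra.mapDomainRingHom ℤ (AddMonoidHom.mulLeft (-2 : ℤ))
  change LaurentPolynomial.eval₂ (Int.castRingHom ℂ) a (F g) = _
  have hT : ∀ k : ℤ, F (LaurentPolynomial.T k) = LaurentPolynomial.T (-2 * k) := by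
    intro k
    change AddMonoidAlgebra.mapDomain (fun k : ℤ => -2 * k) (AddMonoidAlgebra.single k 1) =
      AddMonoidAlgebra.single (-2 * k) 1
    rw [AddMonoidAlgebra.mapDomain_single]
  have hC : ∀ n : ℤ, F (LaurentPolynomial.C n) = LaurentPolynomial.C n := fun n => by
    rw [show (LaurentPolynomial.C n : ℤ[T;T⁻¹]) = ((n : ℤ) : ℤ[T;T⁻¹]) by simp, map_intCast]
  induction g using LaurentPolynomial.induction_on' with
  | add p q hp hq => rw [map_add, map_add, map_add, hp, hq]
  | C_mul_T n k =>
    rw [map_mul, hT, hC, LaurentPolynomial.eval₂_C_mul_T, LaurentPolynomial.eval₂_C_mul_T,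
      zpow_mul]

/-- A letter of the braid has the sign opposite to the right-hand rule. -/
theorem writhe_eq_neg_braidWrithe {m : ℕ} (B : BraidWord (2 * m))
    (o : (platClosure B).Orientation) : LinkDiagram.writhe o = -braidWrithe B o := by
  unfold LinkDiagram.writhe braidWrithe
  rw [← Finset.sum_neg_distrib]
  refine Finset.sum_congr rfl fun k _ => ?_
  have hu := o.underStrand k
  have ho := o.overStrand k
  have hside : ∀ q p, platGlue B (Sum.inr (k, q)) = p →
      (platEquiv B).symm p = Sum.inr (k, q) := fun q p h => by
    rw [Equiv.symm_apply_eq]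
    exact h.symm
  unfold LinkDiagram.sign
  cases hb : B[k].2
  · rw [hside 0 _ (by simp [platGlue, hb, -Fin.getElem_fin]),
      hside 3 _ (by simp [platGlue, hb, -Fin.getElem_fin])]
    revert hu ho
    generalize o.out (Sum.inr (k, 0)) = a
    generalize o.out (Sum.inr (k, 1)) = b
    generalize o.out (Sum.inr (k, 2)) = c
    generalize o.out (Sum.inr (k, 3)) = d
    revert a b c d
    decide
  · rw [hside 1 _ (by simp [platGlue, hb, -Fin.getElem_fin]),
      hside 0 _ (by simp [platGlue, hb, -Fin.getElem_fin])]
    revert hu ho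
    generalize o.out (Sum.inr (k, 0)) = a
    generalize o.out (Sum.inr (k, 1)) = b
    generalize o.out (Sum.inr (k, 2)) = c
    generalize o.out (Sum.inr (k, 3)) = d
    revert a b c d
    decide

theorem eval₂_bracket (D : LinkDiagram) :
    LaurentPolynomial.eval₂ (Int.castRingHom ℂ) bracketUnit D.bracket =
      ∑ s : D.Crossing → Bool,
        bracketVar ^ D.smoothingIndex s * (Real.goldenRatio : ℂ) ^ (D.loops s - 1) := by
  unfold LinkDiagram.bracket
  rw [map_sum]
  refine Finset.sum_congr rfl fun s _ => ?_
  rw [map_mul, map_pow, map_sub, map_neg, LaurentPolynomial.eval₂_T, LaurentPolynomial.eval₂_T,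
    LaurentPolynomial.eval₂_T, Units.val_zpow_eq_zpow_val, Units.val_zpow_eq_zpow_val,
    Units.val_zpow_eq_zpow_val, bracketUnit, Units.val_mk0]
  congr 2
  rw [← neg_bracketVar_sq_sub, zpow_neg, inv_pow]
  norm_cast

theorem eval₂_jones {D : LinkDiagram} (o : D.Orientation) :
    LaurentPolynomial.eval₂ (Int.castRingHom ℂ) sqrtFifthRoot (LinkDiagram.jones o) =
      (-bracketVar) ^ (-3 * LinkDiagram.writhe o) *
        ∑ s : D.Crossing → Bool,
          bracketVar ^ D.smoothingIndex s * (Real.goldenRatio : ℂ) ^ (D.loops s - 1) := by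
  rw [sqrtFifthRoot_eq, ← eval₂_mapDomain, LinkDiagram.mapDomain_jones,
    LinkDiagram.normalizedBracket, map_mul, eval₂_bracket, LaurentPolynomial.eval₂_C_mul_T,
    Units.val_zpow_eq_zpow_val, bracketUnit, Units.val_mk0]
  congr 1
  have h : (-1 : ℂ) ^ (-3 : ℤ) = -1 := by norm_num
  rw [← neg_one_mul bracketVar, mul_zpow, zpow_mul (-1), h]
  congr 1
  rcases Int.even_or_odd (LinkDiagram.writhe o) with hw | hw
  · simp [hw.neg_one_zpow]
  · simp [hw.neg_one_zpow]

end FibonacciPlat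

end

open FibonacciPlat in
theorem mainTheorem1 (m : ℕ) (hm : 0 < m) (B : BraidWord (2 * m))
    (o : (platClosure B).Orientation)
    (W : Matrix {x : Bits3 // ¬ IsFib3 x} {x : Bits3 // ¬ IsFib3 x} ℂ)
    (hW : W ∈ Matrix.unitaryGroup {x : Bits3 // ¬ IsFib3 x} ℂ) :
    LaurentPolynomial.eval₂ (Int.castRingHom ℂ) sqrtFifthRoot (LinkDiagram.jones o) =
      (-Complex.exp (-(3 * Real.pi / 5) * Complex.I)) ^ (3 * braidWrithe B o) *
        ((Real.goldenRatio ^ (((2 * m + 1 : ℕ) : ℝ) / 2 - 3 / 2) : ℝ) : ℂ) *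
        braidOperator W B (alphaString (2 * m)) (alphaString (2 * m)) := by
  have hphi : ((Real.goldenRatio ^ (((2 * m + 1 : ℕ) : ℝ) / 2 - 3 / 2) : ℝ) : ℂ) =
      (Real.goldenRatio : ℂ) ^ (m - 1) := by
    rw [show ((2 * m + 1 : ℕ) : ℝ) / 2 - 3 / 2 = ((m - 1 : ℕ) : ℝ) by
      push_cast [Nat.cast_sub hm]; ring, Real.rpow_natCast]
    push_cast
    rfl
  rw [eval₂_jones, writhe_eq_neg_braidWrithe, hphi, mul_assoc, braidOperator_alphaString,
    Finset.mul_sum (a := (Real.goldenRatio : ℂ) ^ (m - 1))]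
  congr 1
  · congr 1
    ring
  refine Finset.sum_congr rfl fun s _ => ?_
  rw [mul_left_comm]
  congr 1
  refine mul_left_cancel₀ goldenRatio_complex_ne_zero ?_
  rw [← mul_assoc, ← pow_succ', ← pow_succ', Nat.sub_add_cancel hm,
    Nat.sub_add_cancel (loops_pos hm B s), goldenRatio_pow_mul_wordMatrix]
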